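/- Fix the scalar field $\mathbb K\in\{\mathbb R,\mathbb C\}$; operators are bounded linear maps between Banach spaces over $\mathbb K$, and $\omega_1$ is the first uncountable ordinal. **Operators.** An operator $S\colon W\to Z$ *factors through* $T\colon X\to Y$ if there are operators $U\colon W\to X$, $V\colon Y\to Z$ with $VTU=S$. An operator $\Upsilon$ is *universal* for a class $\mathscr C$ of operators if $\Upsilon\in\mathscr C$ and $\Upsilon$ factors through every element of $\mathscr C$. **Szlenk index.** For $K\subseteq X^\ast$ weak$^\ast$-compact and $\epsilon>0$ let $s_\epsilon(K)$ be the set of $x^\ast\in K$ such that $\operatorname{diam}(\mathcal U\cap K)>\epsilon$ (norm diameter) for every weak$^\ast$-open $\mathcal U\ni x^\ast$. Put $s^0_\epsilon(K)=K$, $s^{\xi+1}_\epsilon(K)=s_\epsilon(s^\xi_\epsilon(K))$, and $s^\xi_\epsilon(K)=\bigcap_{\zeta<\xi}s^\zeta_\epsilon(K)$ for limit $\xi$. Let $Sz(K,\epsilon)$ be the least ordinal $\xi$ with $s^\xi_\epsilon(K)=\emptyset$, if there is one, and let $Sz(K)=\sup_{\epsilon>0}Sz(K,\epsilon)$, which is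 undefined if some $Sz(K,\epsilon)$ is undefined. For $T\colon X\to Y$ put $Sz(T)=Sz(T^\ast(B_{Y^\ast}))$, where $B_{Y^\ast}$ is the closed unit ball of $Y^\ast$. For an ordinal $\alpha$ let $\mathscr{SZ}_\alpha$ be the class of operators $T$ for which $Sz(T)$ is defined and $Sz(T)\le\omega^\alpha$, and let $\complement\mathscr{SZ}_\alpha$ be its complement in the class of all operators. **Trees.** A *tree* is a partially ordered set $(\mathcal T,\preceq)$ in which $\{s\mid s\preceq t\}$ is well-ordered for each $t$. It is *rooted* if it has at most one minimal element, and *well-founded* if it has no infinite branch (maximal chain). Put $\mathcal T^{(0)}=\mathcal T$, let $\mathcal T^{(\xi+1)}$ be $\mathcal T^{(\xi)}$ without its maximal elements, and $\mathcal T^{(\xi)}=\bigcap_{\zeta<\xi}\mathcal T^{(\zeta)}$ for limit $\xi$. For well-founded $\mathcal T$, let $\rho(\mathcal T)=\min\{\xi\mid\mathcal T^{(\xi)}=\emptyset\}$ and, for $t\in\mathcal T$, let $\rho_{\mathcal T}(t)$ be the $\xi$ with $t\in\mathcal T^{(\xi)}\setminus\mathcal T^{(\xi+1)}$. A countable tree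 is *blossomed* if it is rooted, well-founded, and for each non-maximal $t$ there is a bijection $\psi$ from $\omega$ onto the set of minimal elements of $\{s\mid t\prec s\}$ such that $\rho_{\mathcal T}(\psi(m))\le\rho_{\mathcal T}(\psi(n))$ whenever $m\le n$. Let $\mathcal T^\star$ be $\mathcal T$ without its minimal elements, with the induced order. For a tree $\mathcal S$ let $\Sigma_{\mathcal S}\colon\ell_1(\mathcal S)\to\ell_\infty(\mathcal S)$ be the operator $\Sigma_{\mathcal S}w=\big(\sum_{s\preceq t}w(s)\big)_{t\in\mathcal S}$. **Theorem.** 1. Let $\alpha<\omega_1$, let $X,Y$ be Banach spaces, let $T\colon X\to Y$ be an operator with $T\notin\mathscr{SZ}_\alpha$ (that is, $Sz(T)$ is undefined or $Sz(T)>\omega^\alpha$), and let $\mathcal T$ be a countably infinite, rooted, well-founded tree with $\rho(\mathcal T)<\omega^{\alpha+1}$. Then $\Sigma_{\mathcal T^\star}$ factors through $T$. 2. If, moreover, $\mathcal T$ is blossomed and $\rho(\mathcal T)\ge\omega^\alpha$ (so $\mathcal T$ is infinite and $\omega^\alpha\le\rho(\mathcal T)<\omega^{\alpha+1}$), then $\Sigma_{\mathcal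 T^\star}$ is universal for $\complement\mathscr{SZ}_\alpha$. 3. For an ordinal $\beta$, the class $\complement\mathscr{SZ}_\beta$ admits a universal element if and only if $\beta<\omega_1$. -/

import Mathlib

open scoped Ordinal lp ENNReal

universe u

namespace Szlenk

/-! ### Transfinite iteration of a derivation on subsets -/

/-- `iterDeriv d A 0 = A`, `iterDeriv d A (ξ + 1) = d (iterDeriv d A ξ)`, and
`iterDeriv d A ξ = ⋂ ζ < ξ, iterDeriv d A ζ` for limit `ξ`. -/
noncomputable def iterDeriv {S : Type u} (d : Set S → Set S) (A : Set S) (ξ : Ordinal.{u}) :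
    Set S :=
  Ordinal.limitRecOn ξ A (fun _ B => d B) (fun ξ _ B => ⋂ (ζ : Ordinal.{u}) (h : ζ < ξ), B ζ h)

/-! ### Bounded operators between Banach spaces -/

/-- A bounded linear operator between two Banach spaces over `𝕜`. -/
structure BanachOperator (𝕜 : Type) [RCLike 𝕜] : Type (u + 1) where
  /-- the domain -/
  Dom : Type u
  /-- the codomain -/
  Cod : Type u
  [normedDom : NormedAddCommGroup Dom]
  [spaceDom : NormedSpace 𝕜 Dom]
  [completeDom : CompleteSpace Dom]
  [normedCod : NormedAddCommGroup Cod]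
  [spaceCod : NormedSpace 𝕜 Cod]
  [completeCod : CompleteSpace Cod]
  /-- the operator -/
  op : Dom →L[𝕜] Cod

attribute [instance] BanachOperator.normedDom BanachOperator.spaceDom BanachOperator.completeDom
  BanachOperator.normedCod BanachOperator.spaceCod BanachOperator.completeCod

/-- `S` factors through `T`: there are bounded operators `U`, `V` with `V T U = S`. -/
def BanachOperator.FactorsThrough {𝕜 : Type} [RCLike 𝕜] (S T : BanachOperator.{u} 𝕜) : Prop :=
  ∃ (U : S.Dom →L[𝕜] T.Dom) (V : T.Cod →L[𝕜] S.Cod), V ∘L T.op ∘L U = S.op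

/-- `Υ` is universal for the class `C`: it belongs to `C` and factors through every member
of `C`. -/
def IsUniversalFor {𝕜 : Type} [RCLike 𝕜] (Υ : BanachOperator.{u} 𝕜)
    (C : Set (BanachOperator.{u} 𝕜)) : Prop :=
  Υ ∈ C ∧ ∀ T ∈ C, Υ.FactorsThrough T

/-! ### The Szlenk index -/

/-- The derivation `s_ε`: it removes from `K` the points that have a weak*-open neighbourhood
`U` such that `U ∩ K` has norm diameter at most `ε`. -/
def szlenkDeriv {𝕜 : Type} [RCLike 𝕜] {X : Type u} [NormedAddCommGroup X] [NormedSpace 𝕜 X]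
    (ε : ℝ) (K : Set (StrongDual 𝕜 X)) : Set (StrongDual 𝕜 X) :=
  {f | f ∈ K ∧ ∀ U : Set (WeakDual 𝕜 X), IsOpen U → StrongDual.toWeakDual f ∈ U →
    ENNReal.ofReal ε < Metric.ediam ((StrongDual.toWeakDual ⁻¹' U) ∩ K)}

open Classical in
/-- The `ε`-Szlenk index `Sz(K, ε)` of a set `K` of functionals: the least `ξ` for which the
`ξ`-th iterate of `s_ε` is empty, with value `⊤` (undefined) if there is none. -/
noncomputable def szlenkIndexAt {𝕜 : Type} [RCLike 𝕜] {X : Type u} [NormedAddCommGroup X]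
    [NormedSpace 𝕜 X] (K : Set (StrongDual 𝕜 X)) (ε : ℝ) : WithTop Ordinal.{u} :=
  if ∃ ξ : Ordinal.{u}, iterDeriv (szlenkDeriv ε) K ξ = ∅ then
    ((sInf {ξ : Ordinal.{u} | iterDeriv (szlenkDeriv ε) K ξ = ∅} : Ordinal.{u}) :
      WithTop Ordinal.{u})
  else ⊤

/-- The Szlenk index `Sz(K) = sup_{ε > 0} Sz(K, ε)`, with value `⊤` if it is undefined. -/
noncomputable def szlenkIndex {𝕜 : Type} [RCLike 𝕜] {X : Type u} [NormedAddCommGroup X]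
    [NormedSpace 𝕜 X] (K : Set (StrongDual 𝕜 X)) : WithTop Ordinal.{u} :=
  ⨆ (ε : ℝ) (_ : 0 < ε), szlenkIndexAt K ε

/-- The Szlenk index of an operator `T`, that is, of the image of the closed unit ball of
the dual of the codomain under the adjoint of `T`. -/
noncomputable def BanachOperator.szlenkIndex {𝕜 : Type} [RCLike 𝕜] (T : BanachOperator.{u} 𝕜) :
    WithTop Ordinal.{u} :=
  Szlenk.szlenkIndex
    ((fun g : StrongDual 𝕜 T.Cod => (g ∘L T.op : StrongDual 𝕜 T.Dom)) '' Metric.closedBall 0 1)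

/-- The class of `α`-Szlenk operators: those with `Sz(T) ≤ ω ^ α`. -/
def SZ (𝕜 : Type) [RCLike 𝕜] (α : Ordinal.{u}) : Set (BanachOperator.{u} 𝕜) :=
  {T | T.szlenkIndex ≤ ((ω ^ α : Ordinal.{u}) : WithTop Ordinal.{u})}

/-! ### Trees -/

/-- A partial order is a tree if the set of predecessors of each node is well-ordered. -/
def IsTree (𝒯 : Type u) [PartialOrder 𝒯] : Prop :=
  ∀ t : 𝒯, IsWellOrder (Set.Iic t) (· < ·)

/-- A tree is rooted if it has at most one minimal element. -/
def IsRooted (𝒯 : Type u) [PartialOrder 𝒯] : Prop :=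
  {t : 𝒯 | IsMin t}.Subsingleton

/-- A tree is well-founded if it has no infinite branch (maximal chain). -/
def IsWellFoundedTree (𝒯 : Type u) [PartialOrder 𝒯] : Prop :=
  ∀ B : Set 𝒯, IsMaxChain (· ≤ ·) B → B.Finite

/-- The derived trees: remove the maximal elements, and iterate. -/
noncomputable def derivedTree (𝒯 : Type u) [PartialOrder 𝒯] (ξ : Ordinal.{u}) : Set 𝒯 :=
  iterDeriv (fun S : Set 𝒯 => S \ {t | Maximal (· ∈ S) t}) Set.univ ξ

/-- The rank of a node `t`: the ordinal `ξ` for which `t` lies in the `ξ`-th derived tree but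
not in the next one (it exists for each node of a well-founded tree). -/
noncomputable def nodeRank {𝒯 : Type u} [PartialOrder 𝒯] (t : 𝒯) : Ordinal.{u} :=
  sInf {ξ : Ordinal.{u} | t ∈ derivedTree 𝒯 ξ \ derivedTree 𝒯 (ξ + 1)}

/-- The rank of a well-founded tree: the least `ξ` for which the `ξ`-th derived tree is
empty. -/
noncomputable def treeRank (𝒯 : Type u) [PartialOrder 𝒯] : Ordinal.{u} :=
  sInf {ξ : Ordinal.{u} | derivedTree 𝒯 ξ = ∅}

/-- The immediate successors of `t`: the minimal elements of `{s | t < s}`. -/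
def immSucc {𝒯 : Type u} [PartialOrder 𝒯] (t : 𝒯) : Set 𝒯 :=
  {s | Minimal (fun r => t < r) s}

/-- A countable tree is blossomed if it is rooted and well-founded, and the immediate successors
of each non-maximal node can be enumerated bijectively by `ℕ` with non-decreasing ranks. -/
def IsBlossomed (𝒯 : Type u) [PartialOrder 𝒯] : Prop :=
  IsTree 𝒯 ∧ Countable 𝒯 ∧ IsRooted 𝒯 ∧ IsWellFoundedTree 𝒯 ∧
    ∀ t : 𝒯, ¬ IsMax t → ∃ ψ : ℕ ≃ immSucc t,
      ∀ m n : ℕ, m ≤ n → nodeRank (ψ m : 𝒯) ≤ nodeRank (ψ n : 𝒯)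

/-- The subtree obtained by deleting the minimal elements. -/
abbrev Star (𝒯 : Type u) [PartialOrder 𝒯] : Type u :=
  {t : 𝒯 // ¬ IsMin t}

/-! ### The summation operator of a tree -/

theorem summable_norm_of_l1 {𝕜 : Type} [RCLike 𝕜] {ι : Type u} (w : ℓ^1(ι, 𝕜)) :
    Summable fun s => ‖w s‖ := by
  have h := (lp.memℓp w).summable (by simp)
  simpa using h

theorem norm_sum_le {𝕜 : Type} [RCLike 𝕜] {ι : Type u} (w : ℓ^1(ι, 𝕜)) (A : Set ι) :
    ‖∑' s : A, w s‖ ≤ ‖w‖ := by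
  have h := summable_norm_of_l1 w
  have hw : ‖w‖ = ∑' s, ‖w s‖ := by
    have := lp.norm_eq_tsum_rpow (p := 1) (by simp) w
    simpa using this
  rw [hw]
  exact (norm_tsum_le_tsum_norm (h.subtype A)).trans
    (h.tsum_subtype_le (fun s => ‖w s‖) A (fun s => norm_nonneg _))

/-- `w ↦ (∑_{s ≤ t} w(s))_t`, from `ℓ₁(𝒯)` to `ℓ_∞(𝒯)`. -/
noncomputable def summation (𝕜 : Type) [RCLike 𝕜] (𝒯 : Type u) [PartialOrder 𝒯] :
    ℓ^1(𝒯, 𝕜) →L[𝕜] ℓ^∞(𝒯, 𝕜) :=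
  LinearMap.mkContinuous
    { toFun := fun w =>
        ⟨fun t => ∑' s : Set.Iic t, w s, memℓp_infty ⟨‖w‖, by
          rintro _ ⟨t, rfl⟩
          exact norm_sum_le w (Set.Iic t)⟩⟩
      map_add' := fun v w => by
        ext t
        exact ((summable_norm_of_l1 v).of_norm.subtype (Set.Iic t)).tsum_add
          ((summable_norm_of_l1 w).of_norm.subtype (Set.Iic t))
      map_smul' := fun c w => by
        ext t
        exact tsum_mul_left }
    1 (fun w => by
      rw [one_mul]
      exact lp.norm_le_of_forall_le (norm_nonneg w) fun t => norm_sum_le w (Set.Iic t))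

theorem summation_apply (𝕜 : Type) [RCLike 𝕜] (𝒯 : Type u) [PartialOrder 𝒯]
    (w : ℓ^1(𝒯, 𝕜)) (t : 𝒯) : summation 𝕜 𝒯 w t = ∑' s : Set.Iic t, w s :=
  rfl

/-- The operator `Σ_𝒯`, as an operator between Banach spaces. -/
noncomputable def summationOperator (𝕜 : Type) [RCLike 𝕜] (𝒯 : Type u) [PartialOrder 𝒯] :
    BanachOperator.{u} 𝕜 where
  Dom := ℓ^1(𝒯, 𝕜)
  Cod := ℓ^∞(𝒯, 𝕜)
  op := summation 𝕜 𝒯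

end Szlenk

/-!
For an operator `T : X → Y` put `K = T*(B_{Y*})`. A functional in the derived set `s_ε^{ξ+1}(K)` is
a weak* limit of functionals of `s_ε^ξ(K)` at norm distance more than `ε / 2` from it; iterating, a
set with large derived sets contains trees of functionals `f_t` in which the increment
`h_t = f_t - f_p` from the immediate predecessor `p` of `t` is weak*-small but not norm-small.

*Factorization.* If `Sz(T) > ω^α`, convexity and symmetry of `K` give, for each `n`, an `ε > 0` with
`s_ε^{ω^α n}(K) ≠ ∅` (`exists_zero_mem_iterDeriv_mul`), which covers every rank below `ω^{α+1}`.
Number the nodes of the tree so that predecessors come first, and choose recursively functionals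
`f_t` in the derived set of order `ρ(t)` together with bounded vectors `x_t` in the common kernel of
the functionals chosen before, such that `h_t(x_t) = 1` and `h_t` is tiny at the vectors chosen
before (`exists_tree_system`). The matrix `h_t(x_s)` is then triangular and a small perturbation of
the identity of `ℓ₁`; its inverse turns `x` into a system biorthogonal to `h`
(`exists_biorthogonal_lift`). Since the increments telescope along the paths of the tree, the lifts
of the functionals `f_t - f_root` to `Y*` and the new vectors factor the summation operator through
`T`.

*Lower bound.* In the dual ball of the summation operator lie the functionals
`w ↦ ∑_{s ≤ t} w(s)`. Those of infinitely many immediate successors of `t` converge weak* to that of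
`t` at distance one, so that in a blossomed tree the functional of a node of rank `ξ` survives `ξ`
derivations (`pathFunctional_mem_iterDeriv`).

*Existence.* For `β < ω₁` a blossomed tree of rank `ω^β + 1` is built from sequences cofinal in
the countable ordinals (`exists_isBlossomed`). For `β ≥ ω₁` a universal operator `Υ` would factor
through two summation operators. The first belongs to a countable tree, so `Υ` factors through a
separable `ℓ₁`; the derived sets of the dual ball of `Υ` therefore stabilize before `ω₁`, at a
nonempty weak* compact set that its derivation leaves invariant (`exists_derived_stable`). The
second belongs to a well-founded tree of large rank; its adjoint takes values in `c₀`
(`finite_setOf_lt_norm_summation`), and weak*-compact sets in `c₀` have relatively weak*-open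
pieces of small diameter by the Baire category theorem (`exists_isOpen_small_of_c0`). This is
inherited by images under adjoints, so there is no such invariant set
(`not_subset_szlenkDeriv_of_factorsThrough`).
-/

namespace Szlenk

/-! ### Iterated derivations -/

section Iteration

variable {S S' : Type u} {d : Set S → Set S} {d' : Set S' → Set S'}

theorem iterDeriv_zero (d : Set S → Set S) (A : Set S) : iterDeriv d A 0 = A :=
  Ordinal.limitRecOn_zero ..

theorem iterDeriv_add_one (d : Set S → Set S) (A : Set S) (ξ : Ordinal.{u}) :
    iterDeriv d A (ξ + 1) = d (iterDeriv d A ξ) :=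
  Ordinal.limitRecOn_add_one ..

theorem iterDeriv_limit (d : Set S → Set S) (A : Set S) {ξ : Ordinal.{u}}
    (hξ : Order.IsSuccLimit ξ) :
    iterDeriv d A ξ = ⋂ (ζ : Ordinal.{u}) (_ : ζ < ξ), iterDeriv d A ζ :=
  Ordinal.limitRecOn_limit _ _ _ _ hξ

theorem iterDeriv_antitone (hd : ∀ B, d B ⊆ B) (A : Set S) {ξ ζ : Ordinal.{u}} (h : ξ ≤ ζ) :
    iterDeriv d A ζ ⊆ iterDeriv d A ξ := by
  induction ζ using Ordinal.limitRecOn with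
  | zero => rw [le_antisymm h (zero_le)]
  | add_one ζ ih =>
    rcases h.eq_or_lt with rfl | h
    · rfl
    · rw [iterDeriv_add_one]
      exact (hd _).trans (ih (Order.lt_add_one_iff.1 h))
  | limit ζ hζ ih =>
    rcases h.eq_or_lt with rfl | h
    · rfl
    · rw [iterDeriv_limit d A hζ]
      exact Set.iInter₂_subset ξ h

theorem iterDeriv_subset (hd : ∀ B, d B ⊆ B) (A : Set S) (ξ : Ordinal.{u}) :
    iterDeriv d A ξ ⊆ A := by
  simpa only [iterDeriv_zero] using iterDeriv_antitone hd A (zero_le (a := ξ))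

/-- A map compatible with one step of two derivations is compatible with their iterates. -/
theorem mapsTo_iterDeriv {φ : S → S'}
    (hφ : ∀ A B, Set.MapsTo φ A B → Set.MapsTo φ (d A) (d' B)) {A : Set S} {B : Set S'}
    (h : Set.MapsTo φ A B) (ξ : Ordinal.{u}) :
    Set.MapsTo φ (iterDeriv d A ξ) (iterDeriv d' B ξ) := by
  induction ξ using Ordinal.limitRecOn with
  | zero => simpa only [iterDeriv_zero] using h
  | add_one ξ ih => simpa only [iterDeriv_add_one] using hφ _ _ ih
  | limit ξ hξ ih =>
    rw [iterDeriv_limit d A hξ, iterDeriv_limit d' B hξ]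
    intro x hx
    simp only [Set.mem_iInter] at hx ⊢
    exact fun ζ hζ => ih ζ hζ (hx ζ hζ)

theorem iterDeriv_iterDeriv_subset (hd : ∀ B, d B ⊆ B) (hmono : Monotone d) (A : Set S)
    (ξ ζ : Ordinal.{u}) :
    iterDeriv d (iterDeriv d A ξ) ζ ⊆ iterDeriv d A (ξ + ζ) := by
  induction ζ using Ordinal.limitRecOn with
  | zero => rw [iterDeriv_zero, add_zero]
  | add_one ζ ih =>
    rw [iterDeriv_add_one, ← add_assoc, iterDeriv_add_one]
    exact hmono ih
  | limit ζ hζ ih =>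
    rw [iterDeriv_limit d _ hζ, iterDeriv_limit d A (Ordinal.isSuccLimit_add ξ hζ)]
    intro x hx
    simp only [Set.mem_iInter] at hx ⊢
    intro η hη
    obtain ⟨ζ', hζ', h⟩ := (Ordinal.lt_add_iff_of_isSuccLimit hζ).1 hη
    exact iterDeriv_antitone hd A h.le (ih ζ' hζ' (hx ζ' hζ'))

end Iteration

/-! ### The Szlenk derivation -/

section Derivation

variable {𝕜 : Type} [RCLike 𝕜] {X : Type u} [NormedAddCommGroup X] [NormedSpace 𝕜 X]

theorem szlenkDeriv_subset (ε : ℝ) (K : Set (StrongDual 𝕜 X)) : szlenkDeriv ε K ⊆ K :=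
  fun _ h => h.1

theorem mem_szlenkDeriv_of_forall_exists {ε : ℝ} (h0 : 0 ≤ ε) {K : Set (StrongDual 𝕜 X)}
    {f : StrongDual 𝕜 X} (hf : f ∈ K)
    (h : ∀ U : Set (WeakDual 𝕜 X), IsOpen U → StrongDual.toWeakDual f ∈ U →
      ∃ g ∈ K, StrongDual.toWeakDual g ∈ U ∧ ε < ‖g - f‖) : f ∈ szlenkDeriv ε K := by
  refine ⟨hf, fun U hU hfU => ?_⟩
  obtain ⟨g, hg, hgU, hgf⟩ := h U hU hfU
  refine lt_of_lt_of_le ?_ (Metric.edist_le_ediam_of_mem (x := g) (y := f) ⟨hgU, hg⟩ ⟨hfU, hf⟩)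
  rw [edist_dist, dist_eq_norm]
  exact (ENNReal.ofReal_lt_ofReal_iff (h0.trans_lt hgf)).2 hgf

theorem exists_far_of_mem_szlenkDeriv {ε : ℝ} {K : Set (StrongDual 𝕜 X)} {f : StrongDual 𝕜 X}
    (hf : f ∈ szlenkDeriv ε K) {U : Set (WeakDual 𝕜 X)} (hU : IsOpen U)
    (hfU : StrongDual.toWeakDual f ∈ U) :
    ∃ g ∈ K, StrongDual.toWeakDual g ∈ U ∧ ε / 2 < ‖g - f‖ := by
  by_contra! h
  refine (hf.2 U hU hfU).not_ge (Metric.ediam_le fun a ha b hb => ?_)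
  rw [edist_dist, dist_eq_norm]
  refine ENNReal.ofReal_le_ofReal ?_
  have h1 := h a ha.2 ha.1
  have h2 := h b hb.2 hb.1
  calc ‖a - b‖ = ‖(a - f) - (b - f)‖ := by rw [sub_sub_sub_cancel_right]
    _ ≤ ‖a - f‖ + ‖b - f‖ := norm_sub_le _ _
    _ ≤ ε := by linarith

theorem isOpen_preimage_affine (c : 𝕜) (v : StrongDual 𝕜 X) {U : Set (WeakDual 𝕜 X)}
    (hU : IsOpen U) :
    IsOpen {w : WeakDual 𝕜 X | c • w + StrongDual.toWeakDual v ∈ U} :=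
  hU.preimage ((continuous_const_smul c).add continuous_const)

/-- The homothety `f ↦ c • f + v` multiplies norm diameters by `‖c‖` and is weak*-continuous, so it
carries `s_ε` into `s_{‖c‖ε}`. -/
theorem mapsTo_szlenkDeriv {ε ε' : ℝ} {c : 𝕜} (hc : c ≠ 0) (v : StrongDual 𝕜 X) (hε : ε' ≤ ‖c‖ * ε)
    {A B : Set (StrongDual 𝕜 X)} (h : Set.MapsTo (fun f => c • f + v) A B) :
    Set.MapsTo (fun f => c • f + v) (szlenkDeriv ε A) (szlenkDeriv ε' B) := by
  intro f hf
  refine ⟨h hf.1, fun U hU hfU => ?_⟩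
  have h1 := hf.2 _ (isOpen_preimage_affine c v hU) (by simpa using hfU)
  obtain ⟨a, ha, b, hb, hab⟩ : ∃ a ∈ (StrongDual.toWeakDual ⁻¹'
      {w : WeakDual 𝕜 X | c • w + StrongDual.toWeakDual v ∈ U}) ∩ A, ∃ b ∈
      (StrongDual.toWeakDual ⁻¹'
      {w : WeakDual 𝕜 X | c • w + StrongDual.toWeakDual v ∈ U}) ∩ A,
      ENNReal.ofReal ε < edist a b := by
    by_contra! h2
    exact h1.not_ge (Metric.ediam_le h2)
  refine lt_of_lt_of_le ?_ (Metric.edist_le_ediam_of_mem (x := c • a + v) (y := c • b + v)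
    ⟨by simpa using ha.1, h ha.2⟩ ⟨by simpa using hb.1, h hb.2⟩)
  rw [edist_dist, dist_eq_norm] at hab ⊢
  obtain ⟨hab', hpos⟩ := ENNReal.ofReal_lt_ofReal_iff'.1 hab
  have h3 : (c • a + v) - (c • b + v) = c • (a - b) := by module
  have hc' : 0 < ‖c‖ := norm_pos_iff.2 hc
  rw [h3, norm_smul]
  refine ENNReal.ofReal_lt_ofReal_iff'.2 ⟨hε.trans_lt ?_, by positivity⟩
  gcongr

theorem szlenkDeriv_mono (ε : ℝ) : Monotone (szlenkDeriv (𝕜 := 𝕜) (X := X) ε) := by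
  intro A B h f hf
  simpa using mapsTo_szlenkDeriv (ε := ε) (ε' := ε) (c := (1 : 𝕜)) one_ne_zero 0 (by simp)
    (A := A) (B := B) (by intro g hg; simpa using h hg) hf

theorem mapsTo_iterDeriv_szlenkDeriv {ε ε' : ℝ} {c : 𝕜} (hc : c ≠ 0)
    (v : StrongDual 𝕜 X) (hε : ε' ≤ ‖c‖ * ε) {A B : Set (StrongDual 𝕜 X)}
    (h : Set.MapsTo (fun f => c • f + v) A B) (ξ : Ordinal.{u}) :
    Set.MapsTo (fun f => c • f + v) (iterDeriv (szlenkDeriv ε) A ξ)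
      (iterDeriv (szlenkDeriv ε') B ξ) :=
  mapsTo_iterDeriv (fun _ _ => mapsTo_szlenkDeriv hc v hε) h ξ

theorem isClosed_szlenkDeriv {ε : ℝ} {K : Set (StrongDual 𝕜 X)}
    (hK : IsClosed (StrongDual.toWeakDual '' K : Set (WeakDual 𝕜 X))) :
    IsClosed (StrongDual.toWeakDual '' szlenkDeriv ε K : Set (WeakDual 𝕜 X)) := by
  rw [← isOpen_compl_iff, isOpen_iff_forall_mem_open]
  intro f hf
  by_cases hfK : f ∈ (StrongDual.toWeakDual '' K : Set (WeakDual 𝕜 X))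
  · obtain ⟨f, hfK, rfl⟩ := hfK
    have hf' : f ∉ szlenkDeriv ε K := fun h => hf ⟨f, h, rfl⟩
    simp only [szlenkDeriv, Set.mem_ofPred_eq, not_and, not_forall] at hf'
    obtain ⟨U, hU, hfU, h⟩ := hf' hfK
    refine ⟨U, ?_, hU, hfU⟩
    rintro _ hg ⟨g, hg', rfl⟩
    exact h (hg'.2 U hU hg)
  · refine ⟨_, ?_, hK.isOpen_compl, hfK⟩
    exact Set.compl_subset_compl.2 (Set.image_mono (szlenkDeriv_subset ε K))

theorem isClosed_iterDeriv_szlenkDeriv {ε : ℝ} {K : Set (StrongDual 𝕜 X)}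
    (hK : IsClosed (StrongDual.toWeakDual '' K : Set (WeakDual 𝕜 X))) (ξ : Ordinal.{u}) :
    IsClosed (StrongDual.toWeakDual '' iterDeriv (szlenkDeriv ε) K ξ : Set (WeakDual 𝕜 X)) := by
  induction ξ using Ordinal.limitRecOn with
  | zero => rwa [iterDeriv_zero]
  | add_one ξ ih =>
    rw [iterDeriv_add_one]
    exact isClosed_szlenkDeriv ih
  | limit ξ hξ ih =>
    rw [iterDeriv_limit _ _ hξ, Set.image_iInter₂ StrongDual.toWeakDual.bijective]
    exact isClosed_biInter ih

end Derivation

/-! ### Dual balls of operators -/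

section DualBall

variable {𝕜 : Type} [RCLike 𝕜]

/-- The set `T*(B_{Y*})` for an operator `T : X → Y`. -/
def BanachOperator.dualBall (T : BanachOperator.{u} 𝕜) : Set (StrongDual 𝕜 T.Dom) :=
  (fun g : StrongDual 𝕜 T.Cod => (g ∘L T.op : StrongDual 𝕜 T.Dom)) '' Metric.closedBall 0 1

theorem not_mem_SZ_iff {T : BanachOperator.{u} 𝕜} {α : Ordinal.{u}} :
    T ∉ SZ 𝕜 α ↔
      ∃ ε : ℝ, 0 < ε ∧ (iterDeriv (szlenkDeriv ε) T.dualBall (ω ^ α)).Nonempty := by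
  have key : ∀ ε : ℝ, szlenkIndexAt T.dualBall ε ≤ ((ω ^ α : Ordinal.{u}) : WithTop Ordinal.{u}) ↔
      iterDeriv (szlenkDeriv ε) T.dualBall (ω ^ α) = ∅ := by
    intro ε
    unfold szlenkIndexAt
    split_ifs with h
    · rw [WithTop.coe_le_coe]
      constructor
      · intro h1
        have h2 : iterDeriv (szlenkDeriv ε) T.dualBall
          (sInf {ξ : Ordinal.{u} | iterDeriv (szlenkDeriv ε) T.dualBall ξ = ∅}) = ∅ := csInf_mem h
        exact Set.subset_empty_iff.1 (h2 ▸ iterDeriv_antitone (szlenkDeriv_subset ε) _ h1)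
      · exact fun h1 => csInf_le' h1
    · simp only [top_le_iff, WithTop.coe_ne_top, false_iff]
      exact fun h1 => h ⟨_, h1⟩
  have : T ∈ SZ 𝕜 α ↔ ∀ ε : ℝ, 0 < ε → iterDeriv (szlenkDeriv ε) T.dualBall (ω ^ α) = ∅ := by
    simp only [← key]
    rw [← iSup₂_le_iff]
    rfl
  rw [this]
  simp only [not_forall, ← Set.nonempty_iff_ne_empty, exists_prop, ← ne_eq]

theorem affine_mem_dualBall {T : BanachOperator.{u} 𝕜} {f g : StrongDual 𝕜 T.Dom} {a b : 𝕜}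
    (hf : f ∈ T.dualBall) (hg : g ∈ T.dualBall) (hab : ‖a‖ + ‖b‖ ≤ 1) :
    a • f + b • g ∈ T.dualBall := by
  obtain ⟨f, hf, rfl⟩ := hf
  obtain ⟨g, hg, rfl⟩ := hg
  rw [mem_closedBall_zero_iff] at hf hg
  refine ⟨a • f + b • g, ?_, ?_⟩
  · rw [mem_closedBall_zero_iff]
    calc ‖a • f + b • g‖ ≤ ‖a‖ * ‖f‖ + ‖b‖ * ‖g‖ := by
          simpa only [norm_smul] using norm_add_le (a • f) (b • g)
      _ ≤ ‖a‖ * 1 + ‖b‖ * 1 := by gcongr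
      _ ≤ 1 := by linarith
  · ext x
    simp

/-- Symmetry and convexity of the dual ball move a point of the `ξ`-th derived set to the
origin. -/
theorem zero_mem_iterDeriv_dualBall {T : BanachOperator.{u} 𝕜} {ε : ℝ} {ξ : Ordinal.{u}}
    (h : (iterDeriv (szlenkDeriv ε) T.dualBall ξ).Nonempty) :
    0 ∈ iterDeriv (szlenkDeriv (ε / 2)) T.dualBall ξ := by
  obtain ⟨f, hf⟩ := h
  have hfK := iterDeriv_subset (szlenkDeriv_subset ε) _ _ hf
  have := mapsTo_iterDeriv_szlenkDeriv (ε := ε) (ε' := ε / 2) (c := (2⁻¹ : 𝕜)) (by simp)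
    (-(2⁻¹ : 𝕜) • f)
    (by simp; linarith) (A := T.dualBall) (B := T.dualBall)
    (fun g hg => affine_mem_dualBall hg hfK (by simp; norm_num)) ξ hf
  beta_reduce at this
  rwa [show (2⁻¹ : 𝕜) • f + -(2⁻¹ : 𝕜) • f = 0 by module] at this

/-- The orders of derived sets containing the origin can be added, at the cost of a smaller
`ε`: a contracted copy of the dual ball lies in each derived set whose order is in the range. -/
theorem zero_mem_iterDeriv_dualBall_add {T : BanachOperator.{u} 𝕜} {ε ε' : ℝ} {ξ ζ : Ordinal.{u}}
    (h : 0 ∈ iterDeriv (szlenkDeriv ε) T.dualBall ξ)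
    (h' : 0 ∈ iterDeriv (szlenkDeriv ε') T.dualBall ζ) :
    0 ∈ iterDeriv (szlenkDeriv (min (ε / 2) (ε' / 2))) T.dualBall (ξ + ζ) := by
  refine iterDeriv_iterDeriv_subset (szlenkDeriv_subset _) (szlenkDeriv_mono _) _ _ _ ?_
  have h1 : Set.MapsTo (fun f : StrongDual 𝕜 T.Dom => (2⁻¹ : 𝕜) • f + 0) T.dualBall
      (iterDeriv (szlenkDeriv (min (ε / 2) (ε' / 2))) T.dualBall ξ) := by
    intro g hg
    have := mapsTo_iterDeriv_szlenkDeriv (ε := ε) (ε' := min (ε / 2) (ε' / 2)) (c := (2⁻¹ : 𝕜))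
      (by simp) ((2⁻¹ : 𝕜) • g) (by simp; left; linarith) (A := T.dualBall) (B := T.dualBall)
      (fun f hf => affine_mem_dualBall hf hg (by simp; norm_num)) ξ h
    beta_reduce at this ⊢
    rwa [show (2⁻¹ : 𝕜) • (0 : StrongDual 𝕜 T.Dom) + (2⁻¹ : 𝕜) • g = (2⁻¹ : 𝕜) • g + 0 by
      module] at this
  have := mapsTo_iterDeriv_szlenkDeriv (ε := ε') (ε' := min (ε / 2) (ε' / 2)) (c := (2⁻¹ : 𝕜))
    (by simp) 0
    (by simp; right; linarith) h1 ζ h'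
  beta_reduce at this
  rwa [show (2⁻¹ : 𝕜) • (0 : StrongDual 𝕜 T.Dom) + 0 = 0 by module] at this

theorem exists_zero_mem_iterDeriv_mul {T : BanachOperator.{u} 𝕜} {α : Ordinal.{u}}
    (hT : T ∉ SZ 𝕜 α) (n : ℕ) :
    ∃ ε : ℝ, 0 < ε ∧ 0 ∈ iterDeriv (szlenkDeriv ε) T.dualBall (ω ^ α * n) := by
  obtain ⟨ε, hε, h⟩ := not_mem_SZ_iff.1 hT
  have h0 := zero_mem_iterDeriv_dualBall h
  induction n with
  | zero =>
    refine ⟨ε / 2, half_pos hε, ?_⟩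
    have := iterDeriv_subset (szlenkDeriv_subset _) _ _ h0
    simpa [iterDeriv_zero] using this
  | succ n ih =>
    obtain ⟨δ, hδ, h1⟩ := ih
    refine ⟨_, ?_, by simpa [mul_add] using zero_mem_iterDeriv_dualBall_add h1 h0⟩
    positivity

end DualBall

/-! ### Well-founded trees -/

section Trees

variable {𝒯 : Type u} [PartialOrder 𝒯]

theorem IsTree.isChain_Iic (h : IsTree 𝒯) (t : 𝒯) : IsChain (· ≤ ·) (Set.Iic t) := by
  intro a ha b hb _
  have := h t
  rcases trichotomous_of (· < ·) (⟨a, ha⟩ : Set.Iic t) ⟨b, hb⟩ with h | h | h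
  · exact Or.inl (le_of_lt (a := (⟨a, ha⟩ : Set.Iic t)) h)
  · exact Or.inl (congrArg Subtype.val h).le
  · exact Or.inr (le_of_lt (a := (⟨b, hb⟩ : Set.Iic t)) h)

theorem IsWellFoundedTree.finite_of_isChain (h : IsWellFoundedTree 𝒯) {C : Set 𝒯}
    (hC : IsChain (· ≤ ·) C) : C.Finite := by
  obtain ⟨M, hM, hCM⟩ := hC.exists_maxChain
  exact (h M hM).subset hCM

theorem IsWellFoundedTree.wellFoundedGT (h : IsWellFoundedTree 𝒯) : WellFoundedGT 𝒯 := by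
  refine ⟨RelEmbedding.wellFounded_iff_isEmpty.2 ⟨fun f => ?_⟩⟩
  have hf : StrictMono f := fun a b hab => f.map_rel_iff.2 hab
  exact Set.infinite_range_of_injective hf.injective
    (h.finite_of_isChain hf.monotone.isChain_range)

theorem exists_isMin_le (h : ∀ t : 𝒯, (Set.Iic t).Finite) (t : 𝒯) : ∃ s ≤ t, IsMin s := by
  obtain ⟨s, hs, hmin⟩ := (h t).exists_minimal ⟨t, le_rfl⟩
  exact ⟨s, hs, fun r hr => hmin (hr.trans hs) hr⟩

/-- A non-minimal node of a tree has an immediate predecessor. -/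
theorem exists_parent (hc : ∀ t : 𝒯, IsChain (· ≤ ·) (Set.Iic t))
    (h : ∀ t : 𝒯, (Set.Iic t).Finite) {t : 𝒯} (ht : ¬ IsMin t) :
    ∃ p < t, ∀ s < t, s ≤ p := by
  obtain ⟨s, hs⟩ := not_isMin_iff.1 ht
  obtain ⟨p, hp, hmax⟩ := ((h t).subset Set.Iio_subset_Iic_self).exists_maximal ⟨s, hs⟩
  refine ⟨p, hp, fun r hr => ?_⟩
  rcases (hc t).total (Set.mem_Iic.2 hr.le) (Set.mem_Iic.2 (le_of_lt hp)) with h1 | h1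
  · exact h1
  · exact hmax hr h1

/-- The nodes of a countable tree can be numbered so that predecessors come first. -/
theorem exists_strictMono_injective_nat [Countable 𝒯] (h : ∀ t : 𝒯, (Set.Iic t).Finite) :
    ∃ ι : 𝒯 → ℕ, StrictMono ι ∧ Function.Injective ι := by
  obtain ⟨e, he⟩ := Countable.exists_injective_nat 𝒯
  -- the binary digits of the number of `t` mark the codes of the nodes up to `t`
  let F : 𝒯 → Finset ℕ := fun t => (h t).toFinset.map ⟨e, he⟩
  have hF : ∀ s t, F s ⊆ F t ↔ s ≤ t := by
    intro s t
    simp only [F, Finset.map_subset_map, Set.Finite.toFinset_subset_toFinset, Set.Iic_subset_Iic]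
  refine ⟨fun t => ∑ i ∈ F t, 2 ^ i, fun s t hst => ?_, fun s t hst => ?_⟩
  · have h1 : F s ⊂ F t := ⟨(hF s t).2 hst.le, fun h2 => hst.not_ge ((hF t s).1 h2)⟩
    obtain ⟨i, hi, hi'⟩ := Finset.exists_of_ssubset h1
    exact Finset.sum_lt_sum_of_subset h1.1 hi hi' (by positivity) fun _ _ _ => Nat.zero_le _
  · have h1 : F s = F t := Finset.geomSum_injective le_rfl hst
    exact le_antisymm ((hF s t).1 h1.subset) ((hF t s).1 h1.symm.subset)

theorem derivedTree_zero : derivedTree 𝒯 0 = Set.univ := iterDeriv_zero _ _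

theorem derivedTree_antitone {ξ ζ : Ordinal.{u}} (h : ξ ≤ ζ) :
    derivedTree 𝒯 ζ ⊆ derivedTree 𝒯 ξ :=
  iterDeriv_antitone (fun _ => Set.sdiff_subset) _ h

theorem mem_derivedTree_limit {ξ : Ordinal.{u}} (hξ : Order.IsSuccLimit ξ) {t : 𝒯} :
    t ∈ derivedTree 𝒯 ξ ↔ ∀ ζ < ξ, t ∈ derivedTree 𝒯 ζ := by
  unfold derivedTree
  rw [iterDeriv_limit _ _ hξ, Set.mem_iInter₂]

theorem mem_derivedTree_of_le {ξ : Ordinal.{u}} {s t : 𝒯} (hst : s ≤ t)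
    (ht : t ∈ derivedTree 𝒯 ξ) : s ∈ derivedTree 𝒯 ξ := by
  induction ξ using Ordinal.limitRecOn with
  | zero => simp [derivedTree_zero]
  | add_one ξ ih =>
    rw [derivedTree, iterDeriv_add_one] at ht ⊢
    refine ⟨ih ht.1, fun hs => ht.2 ?_⟩
    rwa [le_antisymm (hs.2 ht.1 hst) hst]
  | limit ξ hξ ih =>
    rw [mem_derivedTree_limit hξ] at ht ⊢
    exact fun ζ hζ => ih ζ hζ (ht ζ hζ)

theorem mem_derivedTree_add_one {ξ : Ordinal.{u}} {t : 𝒯} :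
    t ∈ derivedTree 𝒯 (ξ + 1) ↔ ∃ s ∈ derivedTree 𝒯 ξ, t < s := by
  rw [derivedTree, iterDeriv_add_one]
  constructor
  · rintro ⟨ht, hmax⟩
    by_contra! h
    exact hmax ⟨ht, fun s hs hts => by
      rcases hts.eq_or_lt with h1 | h1
      · exact h1.ge
      · exact absurd h1 (h s hs)⟩
  · rintro ⟨s, hs, hts⟩
    exact ⟨mem_derivedTree_of_le hts.le hs, fun hmax => hts.not_ge (hmax.2 hs hts.le)⟩

theorem exists_derivedTree_eq_empty [WellFoundedGT 𝒯] :
    ∃ ξ : Ordinal.{u}, derivedTree 𝒯 ξ = ∅ := by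
  by_contra! h
  have hlt : ∀ ξ ζ : Ordinal.{u}, ξ < ζ → derivedTree 𝒯 ξ ≠ derivedTree 𝒯 ζ := by
    intro ξ ζ hξζ heq
    obtain ⟨t, ht, hmax⟩ := WellFounded.has_min (wellFounded_gt (α := 𝒯)) _ (h ξ)
    have h1 : t ∈ derivedTree 𝒯 (ξ + 1) :=
      derivedTree_antitone (Order.add_one_le_of_lt hξζ) (heq ▸ ht)
    obtain ⟨s, hs, hts⟩ := mem_derivedTree_add_one.1 h1
    exact hmax s hs hts
  refine not_injective_of_ordinal (fun ξ : Ordinal.{u} => derivedTree 𝒯 ξ) fun ξ ζ heq => ?_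
  rcases lt_trichotomy ξ ζ with h1 | h1 | h1
  · exact absurd heq (hlt _ _ h1)
  · exact h1
  · exact absurd heq.symm (hlt _ _ h1)

theorem derivedTree_treeRank [WellFoundedGT 𝒯] : derivedTree 𝒯 (treeRank 𝒯) = ∅ :=
  csInf_mem (s := {ξ : Ordinal.{u} | derivedTree 𝒯 ξ = ∅}) exists_derivedTree_eq_empty

theorem derivedTree_nonempty_of_lt_treeRank {ξ : Ordinal.{u}} (h : ξ < treeRank 𝒯) :
    (derivedTree 𝒯 ξ).Nonempty :=
  Set.nonempty_iff_ne_empty.2 fun h1 =>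
    notMem_of_lt_csInf' (s := {ξ : Ordinal.{u} | derivedTree 𝒯 ξ = ∅}) h h1

theorem nodeRank_eq_of_mem {t : 𝒯} {ξ : Ordinal.{u}}
    (h : t ∈ derivedTree 𝒯 ξ \ derivedTree 𝒯 (ξ + 1)) : nodeRank t = ξ := by
  have h1 : nodeRank t ∈ {ξ : Ordinal.{u} | t ∈ derivedTree 𝒯 ξ \ derivedTree 𝒯 (ξ + 1)} :=
    csInf_mem ⟨ξ, h⟩
  have h2 : ∀ ζ η : Ordinal.{u}, t ∈ derivedTree 𝒯 ζ → t ∉ derivedTree 𝒯 (η + 1) → ζ ≤ η := by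
    intro ζ η hζ hη
    by_contra! hlt
    exact hη (derivedTree_antitone (Order.add_one_le_of_lt hlt) hζ)
  exact le_antisymm (h2 _ _ h1.1 h.2) (h2 _ _ h.1 h1.2)

theorem mem_derivedTree_nodeRank [WellFoundedGT 𝒯] (t : 𝒯) :
    t ∈ derivedTree 𝒯 (nodeRank t) \ derivedTree 𝒯 (nodeRank t + 1) := by
  have hne : {ξ : Ordinal.{u} | t ∉ derivedTree 𝒯 ξ}.Nonempty :=
    ⟨treeRank 𝒯, by simp [derivedTree_treeRank]⟩
  have h1 : t ∉ derivedTree 𝒯 (sInf {ξ : Ordinal.{u} | t ∉ derivedTree 𝒯 ξ}) := csInf_mem hne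
  have h2 : ∀ ζ < sInf {ξ : Ordinal.{u} | t ∉ derivedTree 𝒯 ξ}, t ∈ derivedTree 𝒯 ζ :=
    fun ζ hζ => not_not.1 (notMem_of_lt_csInf' (s := {ξ : Ordinal.{u} | t ∉ derivedTree 𝒯 ξ}) hζ)
  generalize sInf {ξ : Ordinal.{u} | t ∉ derivedTree 𝒯 ξ} = η at h1 h2
  induction η using Ordinal.limitRecOn with
  | zero => simp [derivedTree_zero] at h1
  | add_one ξ _ =>
    have h3 : t ∈ derivedTree 𝒯 ξ \ derivedTree 𝒯 (ξ + 1) :=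
      ⟨h2 ξ (Order.lt_add_one_iff.2 le_rfl), h1⟩
    rwa [nodeRank_eq_of_mem h3]
  | limit η hη _ => exact absurd ((mem_derivedTree_limit hη).2 h2) h1

theorem nodeRank_lt_treeRank [WellFoundedGT 𝒯] (t : 𝒯) : nodeRank t < treeRank 𝒯 := by
  by_contra! h
  have := derivedTree_antitone h (mem_derivedTree_nodeRank t).1
  simp [derivedTree_treeRank] at this

theorem mem_derivedTree_iff [WellFoundedGT 𝒯] {t : 𝒯} {ξ : Ordinal.{u}} :
    t ∈ derivedTree 𝒯 ξ ↔ ξ ≤ nodeRank t := by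
  refine ⟨fun h => ?_, fun h => derivedTree_antitone h (mem_derivedTree_nodeRank t).1⟩
  by_contra! hlt
  exact (mem_derivedTree_nodeRank t).2 (derivedTree_antitone (Order.add_one_le_of_lt hlt) h)

theorem nodeRank_lt_nodeRank [WellFoundedGT 𝒯] {s t : 𝒯} (h : s < t) :
    nodeRank t < nodeRank s := by
  have : s ∈ derivedTree 𝒯 (nodeRank t + 1) :=
    mem_derivedTree_add_one.2 ⟨t, (mem_derivedTree_nodeRank t).1, h⟩
  exact Order.add_one_le_iff.1 (mem_derivedTree_iff.1 this)

/-- The rank of a node is the least ordinal above the ranks of its strict successors, and this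
property determines the derived trees. -/
theorem mem_derivedTree_iff_of_rank {r : 𝒯 → Ordinal.{u}} (hr : StrictAnti r)
    (hr' : ∀ t, ∀ ξ < r t, ∃ s, t < s ∧ ξ ≤ r s) {t : 𝒯} {ξ : Ordinal.{u}} :
    t ∈ derivedTree 𝒯 ξ ↔ ξ ≤ r t := by
  induction ξ using Ordinal.limitRecOn generalizing t with
  | zero => simp [derivedTree_zero]
  | add_one ξ ih =>
    rw [mem_derivedTree_add_one, Order.add_one_le_iff]
    constructor
    · rintro ⟨s, hs, hts⟩
      exact (ih.1 hs).trans_lt (hr hts)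
    · intro h
      obtain ⟨s, hts, hs⟩ := hr' t ξ h
      exact ⟨s, ih.2 hs, hts⟩
  | limit ξ hξ ih =>
    rw [mem_derivedTree_limit hξ, hξ.le_iff_forall_le]
    exact forall₂_congr fun ζ hζ => ih ζ hζ

theorem nodeRank_eq_of_rank {r : 𝒯 → Ordinal.{u}} (hr : StrictAnti r)
    (hr' : ∀ t, ∀ ξ < r t, ∃ s, t < s ∧ ξ ≤ r s) (t : 𝒯) : nodeRank t = r t := by
  refine nodeRank_eq_of_mem ⟨(mem_derivedTree_iff_of_rank hr hr').2 le_rfl, fun h => ?_⟩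
  exact (Order.lt_add_one_iff.2 le_rfl).not_ge ((mem_derivedTree_iff_of_rank hr hr').1 h)

end Trees

/-! ### Path functionals and the lower bound for the Szlenk index -/

section PathFunctional

variable {𝕜 : Type} [RCLike 𝕜]

theorem summable_of_l1 {ι : Type u} (w : ℓ^1(ι, 𝕜)) : Summable fun s => w s :=
  (summable_norm_of_l1 w).of_norm

theorem tendsto_coord_cofinite {ι : Type u} (w : ℓ^1(ι, 𝕜)) :
    Filter.Tendsto (fun s => w s) Filter.cofinite (nhds 0) :=
  (summable_of_l1 w).tendsto_cofinite_zero

variable {𝒯 : Type u} [PartialOrder 𝒯]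

variable (𝕜) in
/-- The functional `w ↦ ∑_{s ≤ t} w(s)` on `ℓ₁(𝒯*)`, for a node `t` of `𝒯`. -/
noncomputable def pathFunctional (t : 𝒯) : StrongDual 𝕜 ℓ^1(Star 𝒯, 𝕜) :=
  LinearMap.mkContinuous
    { toFun := fun w => ∑' s : {s : Star 𝒯 | (s : 𝒯) ≤ t}, w s
      map_add' := fun v w =>
        ((summable_of_l1 v).subtype _).tsum_add ((summable_of_l1 w).subtype _)
      map_smul' := fun c w => tsum_mul_left }
    1 (fun w => by
      rw [one_mul]
      exact norm_sum_le w _)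

theorem pathFunctional_apply (t : 𝒯) (w : ℓ^1(Star 𝒯, 𝕜)) :
    pathFunctional 𝕜 t w = ∑' s : {s : Star 𝒯 | (s : 𝒯) ≤ t}, w s := rfl

theorem pathFunctional_coe (t : Star 𝒯) (w : ℓ^1(Star 𝒯, 𝕜)) :
    pathFunctional 𝕜 (t : 𝒯) w = summation 𝕜 (Star 𝒯) w t := rfl

theorem pathFunctional_of_isMin {t : 𝒯} (ht : IsMin t) : pathFunctional 𝕜 t = 0 := by
  ext w
  have : IsEmpty {s : Star 𝒯 | (s : 𝒯) ≤ t} :=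
    ⟨fun s => s.1.2 (ht.mono s.2)⟩
  rw [pathFunctional_apply, tsum_empty]
  rfl

theorem pathFunctional_eq_add {s : Star 𝒯} {p : 𝒯} (hp : p < s) (h : ∀ r < (s : 𝒯), r ≤ p)
    (w : ℓ^1(Star 𝒯, 𝕜)) : pathFunctional 𝕜 (s : 𝒯) w = pathFunctional 𝕜 p w + w s := by
  classical
  have hset : {r : Star 𝒯 | (r : 𝒯) ≤ s} = {r : Star 𝒯 | (r : 𝒯) ≤ p} ∪ {s} := by
    ext r
    simp only [Set.mem_ofPred_eq, Set.mem_union, Set.mem_singleton_iff]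
    constructor
    · intro hr
      rcases hr.eq_or_lt with h1 | h1
      · exact Or.inr (Subtype.ext h1)
      · exact Or.inl (h _ h1)
    · rintro (h1 | rfl)
      · exact h1.trans hp.le
      · rfl
  have hd : Disjoint {r : Star 𝒯 | (r : 𝒯) ≤ p} {s} :=
    Set.disjoint_singleton_right.2 fun h1 => hp.not_ge h1
  rw [pathFunctional_apply, pathFunctional_apply, hset,
    ((summable_of_l1 w).subtype _).tsum_union_disjoint hd ((summable_of_l1 w).subtype _),
    tsum_singleton s (fun r => w r)]

theorem pathFunctional_mem_dualBall (t : 𝒯) :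
    pathFunctional 𝕜 t ∈ (summationOperator 𝕜 (Star 𝒯)).dualBall := by
  by_cases ht : IsMin t
  · rw [pathFunctional_of_isMin ht]
    exact ⟨0, by simp, by ext w; rfl⟩
  · let δ : StrongDual 𝕜 ℓ^∞(Star 𝒯, 𝕜) := lp.evalCLM 𝕜 (fun _ : Star 𝒯 => 𝕜) ∞ ⟨t, ht⟩
    have hδ : ‖δ‖ ≤ 1 := ContinuousLinearMap.opNorm_le_bound _ zero_le_one fun w => by
      rw [one_mul]
      exact lp.norm_apply_le_norm ENNReal.top_ne_zero w _
    exact ⟨δ, mem_closedBall_zero_iff.2 hδ, by ext w; rfl⟩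

theorem le_of_lt_of_mem_immSucc (hc : ∀ t : 𝒯, IsChain (· ≤ ·) (Set.Iic t)) {s t : 𝒯}
    (hs : s ∈ immSucc t) {r : 𝒯} (hr : r < s) : r ≤ t := by
  rcases (hc s).total (Set.mem_Iic.2 hr.le) (Set.mem_Iic.2 (le_of_lt hs.1)) with h1 | h1
  · exact h1
  · rcases h1.eq_or_lt with h2 | h2
    · exact h2.ge
    · exact absurd (hs.2 h2 hr.le) hr.not_ge

/-- The path functionals of infinitely many immediate successors of `t` converge weak* to that of
`t`, at norm distance one. -/
theorem pathFunctional_mem_szlenkDeriv (hc : ∀ t : 𝒯, IsChain (· ≤ ·) (Set.Iic t)) {t : 𝒯}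
    {K : Set (StrongDual 𝕜 ℓ^1(Star 𝒯, 𝕜))} (ht : pathFunctional 𝕜 t ∈ K)
    (hinf : {s ∈ immSucc t | pathFunctional 𝕜 s ∈ K}.Infinite) :
    pathFunctional 𝕜 t ∈ szlenkDeriv 2⁻¹ K := by
  refine mem_szlenkDeriv_of_forall_exists (by norm_num) ht fun U hU htU => ?_
  let J : Set 𝒯 := {s ∈ immSucc t | pathFunctional 𝕜 s ∈ K}
  have : Infinite J := hinf.to_subtype
  let e : J → Star 𝒯 := fun s => ⟨s, fun h => h.not_lt s.2.1.1⟩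
  have he : Function.Injective e := fun a b hab => Subtype.ext (congrArg (fun x => x.1) hab)
  have hadd : ∀ (s : J) (w : ℓ^1(Star 𝒯, 𝕜)),
      pathFunctional 𝕜 (s : 𝒯) w = pathFunctional 𝕜 t w + w (e s) := fun s w =>
    pathFunctional_eq_add (s := e s) s.2.1.1 (fun r hr => le_of_lt_of_mem_immSucc hc s.2.1 hr) w
  have hlim : Filter.Tendsto (fun s : J => StrongDual.toWeakDual (pathFunctional 𝕜 (s : 𝒯)))
      Filter.cofinite (nhds (StrongDual.toWeakDual (pathFunctional 𝕜 t))) := by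
    rw [tendsto_iff_forall_eval_tendsto_topDualPairing]
    intro w
    have h1 := ((tendsto_coord_cofinite w).comp he.tendsto_cofinite).const_add
      (pathFunctional 𝕜 t w)
    rw [add_zero] at h1
    exact h1.congr fun s => (hadd s w).symm
  obtain ⟨s, hs⟩ := (hlim.eventually (hU.mem_nhds htU)).exists
  refine ⟨pathFunctional 𝕜 (s : 𝒯), s.2.2, hs, ?_⟩
  classical
  have h1 := (pathFunctional 𝕜 (s : 𝒯) - pathFunctional 𝕜 t).le_opNorm
    (lp.single 1 (e s) (1 : 𝕜))
  rw [sub_apply, hadd, add_sub_cancel_left, lp.single_apply_self,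
    lp.norm_single one_pos, norm_one, mul_one] at h1
  linarith

theorem pathFunctional_mem_iterDeriv (hc : ∀ t : 𝒯, IsChain (· ≤ ·) (Set.Iic t))
    (hinf : ∀ (t : 𝒯) (ξ : Ordinal.{u}), t ∈ derivedTree 𝒯 (ξ + 1) →
      {s ∈ immSucc t | s ∈ derivedTree 𝒯 ξ}.Infinite)
    {K : Set (StrongDual 𝕜 ℓ^1(Star 𝒯, 𝕜))} (hK : ∀ t : 𝒯, pathFunctional 𝕜 t ∈ K)
    {t : 𝒯} {ξ : Ordinal.{u}} (ht : t ∈ derivedTree 𝒯 ξ) :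
    pathFunctional 𝕜 t ∈ iterDeriv (szlenkDeriv 2⁻¹) K ξ := by
  induction ξ using Ordinal.limitRecOn generalizing t with
  | zero =>
    rw [iterDeriv_zero]
    exact hK t
  | add_one ξ ih =>
    rw [iterDeriv_add_one]
    refine pathFunctional_mem_szlenkDeriv hc (ih (derivedTree_antitone le_self_add ht)) ?_
    exact (hinf t ξ ht).mono fun s hs => ⟨hs.1, ih hs.2⟩
  | limit ξ hξ ih =>
    rw [iterDeriv_limit _ _ hξ, Set.mem_iInter₂]
    exact fun ζ hζ => ih ζ hζ ((mem_derivedTree_limit hξ).1 ht ζ hζ)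

/-- If each node of the derived tree of order `ξ + 1` has infinitely many immediate successors in
the derived tree of order `ξ`, then the Szlenk index exceeds every `ω ^ α` for which the derived
tree of order `ω ^ α` is nonempty. -/
theorem summationOperator_not_mem_SZ (hc : ∀ t : 𝒯, IsChain (· ≤ ·) (Set.Iic t))
    (hinf : ∀ (t : 𝒯) (ξ : Ordinal.{u}), t ∈ derivedTree 𝒯 (ξ + 1) →
      {s ∈ immSucc t | s ∈ derivedTree 𝒯 ξ}.Infinite) {α : Ordinal.{u}}
    (h : (derivedTree 𝒯 (ω ^ α)).Nonempty) :
    summationOperator 𝕜 (Star 𝒯) ∉ SZ 𝕜 α :=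
  not_mem_SZ_iff.2 ⟨2⁻¹, by norm_num, _,
    pathFunctional_mem_iterDeriv hc hinf pathFunctional_mem_dualBall h.some_mem⟩

theorem IsBlossomed.infinite_immSucc (h : IsBlossomed 𝒯) (t : 𝒯) (ξ : Ordinal.{u})
    (ht : t ∈ derivedTree 𝒯 (ξ + 1)) : {s ∈ immSucc t | s ∈ derivedTree 𝒯 ξ}.Infinite := by
  obtain ⟨htree, -, -, hwf, hψ⟩ := h
  have := hwf.wellFoundedGT
  obtain ⟨s, hs, hts⟩ := mem_derivedTree_add_one.1 ht
  obtain ⟨ψ, hψ⟩ := hψ t fun hmax => hmax.not_lt hts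
  have hfin : (Set.Ioc t s).Finite :=
    (hwf.finite_of_isChain (htree.isChain_Iic s)).subset Set.Ioc_subset_Iic_self
  obtain ⟨r, hr, hmin⟩ := hfin.exists_minimal ⟨s, hts, le_rfl⟩
  have hrt : r ∈ immSucc t := ⟨hr.1, fun q hq hqr => hmin ⟨hq, hqr.trans hr.2⟩ hqr⟩
  obtain ⟨m, hm⟩ := ψ.surjective ⟨r, hrt⟩
  have hinj : Function.Injective fun n => (ψ n : 𝒯) := Subtype.val_injective.comp ψ.injective
  refine ((Set.Ici_infinite m).image hinj.injOn).mono ?_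
  rintro _ ⟨n, hn, rfl⟩
  refine ⟨(ψ n).2, mem_derivedTree_iff.2 ((mem_derivedTree_iff.1 ?_).trans (hψ m n hn))⟩
  rw [hm]
  exact mem_derivedTree_of_le hr.2 hs

/-- The root lies in every nonempty derived tree, so it survives at limit stages; at the stage
`ω ^ 0 = 1` it survives because the tree has another node. -/
theorem derivedTree_opow_nonempty [Infinite 𝒯] (hfin : ∀ t : 𝒯, (Set.Iic t).Finite)
    (hroot : IsRooted 𝒯) {α : Ordinal.{u}} (h : ω ^ α ≤ treeRank 𝒯) :
    (derivedTree 𝒯 (ω ^ α)).Nonempty := by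
  obtain ⟨t₀⟩ : Nonempty 𝒯 := inferInstance
  obtain ⟨r, -, hr⟩ := exists_isMin_le hfin t₀
  have hle : ∀ t : 𝒯, r ≤ t := fun t => by
    obtain ⟨s, hst, hs⟩ := exists_isMin_le hfin t
    rwa [hroot hr hs]
  refine ⟨r, ?_⟩
  rcases eq_or_ne α 0 with rfl | hα
  · obtain ⟨t, ht⟩ := exists_ne r
    rw [Ordinal.opow_zero, ← zero_add (1 : Ordinal.{u}), mem_derivedTree_add_one]
    exact ⟨t, by simp [derivedTree_zero], lt_of_le_of_ne (hle t) ht.symm⟩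
  · have hlim : Order.IsSuccLimit (ω ^ α : Ordinal.{u}) :=
      Ordinal.isSuccLimit_opow_left Ordinal.isSuccLimit_omega0 hα
    rw [mem_derivedTree_limit hlim]
    intro ζ hζ
    obtain ⟨t, ht⟩ := derivedTree_nonempty_of_lt_treeRank (hζ.trans_le h)
    exact mem_derivedTree_of_le (hle t) ht

end PathFunctional

/-! ### Selecting vectors against finite sets of functionals -/

section Selection

variable {𝕜 : Type} [RCLike 𝕜] {X : Type u} [NormedAddCommGroup X] [NormedSpace 𝕜 X]

/-- A finite-dimensional space of functionals is normed, up to the factor two, by finitely many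
vectors of the unit ball. -/
theorem exists_finite_norming (M : Submodule 𝕜 (StrongDual 𝕜 X)) [FiniteDimensional 𝕜 M] :
    ∃ Z : Finset X, (∀ z ∈ Z, ‖z‖ ≤ 1) ∧ ∀ e ∈ M, e ≠ 0 → ∃ z ∈ Z, ‖e‖ ≤ 2 * ‖e z‖ := by
  have : ProperSpace M := FiniteDimensional.proper 𝕜 M
  have hcpt : IsCompact (Metric.sphere (0 : M) 1) := isCompact_sphere 0 1
  let O : Metric.closedBall (0 : X) 1 → Set M := fun z => {e | 2⁻¹ < ‖(e : StrongDual 𝕜 X) z‖}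
  have hO : ∀ z, IsOpen (O z) := fun z => by
    refine isOpen_lt continuous_const (Continuous.norm ?_)
    exact ((ContinuousLinearMap.apply 𝕜 𝕜 (z : X)).continuous).comp continuous_subtype_val
  have hcov : Metric.sphere (0 : M) 1 ⊆ ⋃ z, O z := by
    intro e he
    have he : ‖(e : StrongDual 𝕜 X)‖ = 1 := mem_sphere_zero_iff_norm.1 he
    have h1 : ∃ x : X, 2⁻¹ * ‖x‖ < ‖(e : StrongDual 𝕜 X) x‖ := by
      by_contra! h
      have := ContinuousLinearMap.opNorm_le_bound (e : StrongDual 𝕜 X) (by norm_num) h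
      norm_num [he] at this
    obtain ⟨x, hx⟩ := h1
    have hx0 : x ≠ 0 := by
      rintro rfl
      simp at hx
    have hxn : 0 < ‖x‖ := norm_pos_iff.2 hx0
    have hn : ‖((‖x‖⁻¹ : ℝ) : 𝕜)‖ = ‖x‖⁻¹ := by simp
    refine Set.mem_iUnion.2 ⟨⟨((‖x‖⁻¹ : ℝ) : 𝕜) • x, ?_⟩, ?_⟩
    · rw [mem_closedBall_zero_iff, norm_smul, hn, inv_mul_cancel₀ hxn.ne']
    · change 2⁻¹ < ‖(e : StrongDual 𝕜 X) (((‖x‖⁻¹ : ℝ) : 𝕜) • x)‖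
      rw [map_smul, norm_smul, hn, inv_mul_eq_div, lt_div_iff₀ hxn]
      exact hx
  obtain ⟨Z, hZ⟩ := hcpt.elim_finite_subcover O hO hcov
  classical
  refine ⟨Z.image Subtype.val, ?_, fun e he he0 => ?_⟩
  · intro z hz
    obtain ⟨z, -, rfl⟩ := Finset.mem_image.1 hz
    exact mem_closedBall_zero_iff.1 z.2
  · have hen : 0 < ‖e‖ := norm_pos_iff.2 he0
    have hn : ‖((‖e‖⁻¹ : ℝ) : 𝕜)‖ = ‖e‖⁻¹ := by simp
    have h1 : ((‖e‖⁻¹ : ℝ) : 𝕜) • (⟨e, he⟩ : M) ∈ Metric.sphere (0 : M) 1 := by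
      refine mem_sphere_zero_iff_norm (E := M).2 ?_
      change ‖((‖e‖⁻¹ : ℝ) : 𝕜) • e‖ = 1
      rw [norm_smul, hn, inv_mul_cancel₀ hen.ne']
    obtain ⟨z, hz, hez⟩ := Set.mem_iUnion₂.1 (hZ h1)
    refine ⟨z, Finset.mem_image_of_mem _ hz, ?_⟩
    have h2 : 2⁻¹ < ‖((‖e‖⁻¹ : ℝ) : 𝕜) * e z‖ := hez
    rw [norm_mul, hn, inv_mul_eq_div, lt_div_iff₀ hen] at h2
    linarith

/-- A functional at distance at least `d` from the span of a finite set `E` takes the value one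
at a vector of norm at most `2 / d` in the common kernel of `E`. -/
theorem exists_vector_of_le_dist_span {E : Set (StrongDual 𝕜 X)} (hE : E.Finite)
    (g : StrongDual 𝕜 X) {d : ℝ} (hd : 0 < d)
    (h : ∀ e ∈ Submodule.span 𝕜 E, d ≤ ‖g - e‖) :
    ∃ x : X, ‖x‖ ≤ 2 / d ∧ g x = 1 ∧ ∀ e ∈ E, e x = 0 := by
  have := hE.to_subtype
  let L : E → (X →ₗ[𝕜] 𝕜) := fun e => ((e : StrongDual 𝕜 X) : X →ₗ[𝕜] 𝕜)
  let P : Submodule 𝕜 X := ⨅ e, LinearMap.ker (L e)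
  obtain ⟨ĝ, hĝ, hnorm⟩ := exists_extension_norm_eq P (g ∘L P.subtypeL)
  have hker : P ≤ LinearMap.ker ((g - ĝ : StrongDual 𝕜 X) : X →ₗ[𝕜] 𝕜) := by
    intro x hx
    have h1 : ĝ x = g x := hĝ ⟨x, hx⟩
    simp [h1]
  have hspan := mem_span_of_iInf_ker_le_ker hker
  have := Fintype.ofFinite E
  rw [Submodule.mem_span_range_iff_exists_fun] at hspan
  obtain ⟨c, hc⟩ := hspan
  have hmem : g - ĝ ∈ Submodule.span 𝕜 E := by
    have h2 : g - ĝ = ∑ e : E, c e • (e : StrongDual 𝕜 X) := by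
      ext x
      have h3 := LinearMap.congr_fun hc x
      simpa [L] using h3.symm
    rw [h2]
    exact Submodule.sum_mem _ fun e _ => Submodule.smul_mem _ _ (Submodule.subset_span e.2)
  have hdist : d ≤ ‖ĝ‖ := by simpa using h _ hmem
  have hw : ∃ w : P, d / 2 * ‖w‖ < ‖g w‖ := by
    by_contra! h4
    have h5 := ContinuousLinearMap.opNorm_le_bound (g ∘L P.subtypeL) (by positivity) h4
    linarith
  obtain ⟨w, hw⟩ := hw
  have hgw : 0 < ‖g w‖ := lt_of_le_of_lt (by positivity) hw
  have hgw0 : g w ≠ 0 := norm_pos_iff.1 hgw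
  refine ⟨(g w)⁻¹ • (w : X), ?_, ?_, fun e he => ?_⟩
  · rw [norm_smul, norm_inv, inv_mul_le_iff₀ hgw, mul_div_assoc', le_div_iff₀ hd]
    change d / 2 * ‖(w : X)‖ < ‖g w‖ at hw
    linarith
  · rw [map_smul, smul_eq_mul, inv_mul_cancel₀ hgw0]
  · have h6 : e w = 0 := (Submodule.mem_iInf _).1 w.2 ⟨e, he⟩
    rw [map_smul, h6, smul_zero]

/-- A functional `g` that is weak*-near `f₀` but not norm-near is far from any given
finite-dimensional space, up to `f₀`: a vector of the unit ball norming `e` to within a factor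
two, for `e` in that space, nearly annihilates `g - f₀`. -/
theorem exists_isOpen_forall_exists_vector {E : Set (StrongDual 𝕜 X)} (hE : E.Finite) {Z : Set X}
    (hZ : Z.Finite) (f₀ : StrongDual 𝕜 X) {δ τ : ℝ} (hδ : 0 < δ) (hτ : 0 < τ) :
    ∃ U : Set (WeakDual 𝕜 X), IsOpen U ∧ StrongDual.toWeakDual f₀ ∈ U ∧
      ∀ g : StrongDual 𝕜 X, StrongDual.toWeakDual g ∈ U → δ < ‖g - f₀‖ →
        (∀ z ∈ Z, ‖(g - f₀) z‖ ≤ τ) ∧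
        ∃ x : X, ‖x‖ ≤ 8 / δ ∧ (g - f₀) x = 1 ∧ ∀ e ∈ E, e x = 0 := by
  have := FiniteDimensional.span_of_finite 𝕜 hE
  obtain ⟨Z', hZ'1, hZ'⟩ := exists_finite_norming (Submodule.span 𝕜 E)
  have hopen : ∀ (z : X) (r : ℝ), IsOpen {g : WeakDual 𝕜 X | ‖g z - f₀ z‖ < r} := fun z r =>
    isOpen_lt ((WeakDual.eval_continuous z).sub continuous_const).norm continuous_const
  refine ⟨(⋂ z ∈ Z', {g : WeakDual 𝕜 X | ‖g z - f₀ z‖ < δ / 8}) ∩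
    ⋂ z ∈ Z, {g : WeakDual 𝕜 X | ‖g z - f₀ z‖ < τ}, ?_, ?_, ?_⟩
  · exact (Z'.finite_toSet.isOpen_biInter fun z _ => hopen z _).inter
      (hZ.isOpen_biInter fun z _ => hopen z _)
  · refine ⟨Set.mem_iInter₂.2 fun z _ => ?_, Set.mem_iInter₂.2 fun z _ => ?_⟩
    · simpa using hδ
    · simpa using hτ
  · rintro g ⟨hg1, hg2⟩ hgδ
    rw [Set.mem_iInter₂] at hg1 hg2
    refine ⟨fun z hz => (hg2 z hz).le, ?_⟩
    have hdist : ∀ e ∈ Submodule.span 𝕜 E, δ / 4 ≤ ‖(g - f₀) - e‖ := by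
      intro e he
      rcases eq_or_ne e 0 with rfl | he0
      · rw [sub_zero]
        linarith
      obtain ⟨z, hz, hez⟩ := hZ' e he he0
      have h1 : ‖g z - f₀ z‖ < δ / 8 := hg1 z hz
      have h2 : ‖e z‖ ≤ ‖g z - f₀ z‖ + ‖g - f₀ - e‖ := by
        have h3 : ‖(g - f₀ - e) z‖ ≤ ‖g - f₀ - e‖ :=
          ((g - f₀ - e).le_opNorm z).trans (mul_le_of_le_one_right (norm_nonneg _) (hZ'1 z hz))
        have h4 : e z = (g z - f₀ z) - (g - f₀ - e) z := by simp
        rw [h4]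
        exact (norm_sub_le _ _).trans (by gcongr)
      have h5 : ‖g - f₀‖ ≤ ‖g - f₀ - e‖ + ‖e‖ := by
        simpa using norm_add_le (g - f₀ - e) e
      linarith
    obtain ⟨x, hx, hgx, hex⟩ := exists_vector_of_le_dist_span hE (g - f₀) (by positivity) hdist
    exact ⟨x, hx.trans_eq (by field_simp; norm_num), hgx, hex⟩

end Selection

/-! ### Assembling a biorthogonal system from an almost biorthogonal one -/

section Assembly

variable {𝕜 : Type} [RCLike 𝕜] {X : Type*} [NormedAddCommGroup X] [NormedSpace 𝕜 X]

open Classical in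
/-- The universal property of `ℓ₁` for bounded families. -/
theorem exists_l1_lift [CompleteSpace X] {S : Type u} (x : S → X) {C : ℝ} (hC : 0 ≤ C)
    (hx : ∀ s, ‖x s‖ ≤ C) :
    ∃ U : ℓ^1(S, 𝕜) →L[𝕜] X, (∀ s, U (lp.single 1 s (1 : 𝕜)) = x s) ∧ ‖U‖ ≤ C := by
  have hbound : ∀ (w : ℓ^1(S, 𝕜)) s, ‖w s • x s‖ ≤ ‖w s‖ * C := fun w s => by
    rw [norm_smul]
    gcongr
    exact hx s
  have hsum : ∀ w : ℓ^1(S, 𝕜), Summable fun s => w s • x s := fun w =>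
    Summable.of_norm_bounded ((summable_norm_of_l1 w).mul_right C) (hbound w)
  have hnorm : ∀ w : ℓ^1(S, 𝕜), ‖w‖ = ∑' s, ‖w s‖ := fun w => by
    simpa using lp.norm_eq_tsum_rpow (p := 1) (by simp) w
  let U : ℓ^1(S, 𝕜) →L[𝕜] X := LinearMap.mkContinuous
    { toFun := fun w => ∑' s, w s • x s
      map_add' := fun v w => by
        simp only [lp.coeFn_add, Pi.add_apply, add_smul]
        exact (hsum v).tsum_add (hsum w)
      map_smul' := fun c w => by
        simp only [lp.coeFn_smul, Pi.smul_apply, smul_assoc, RingHom.id_apply]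
        exact (hsum w).tsum_const_smul c }
    C (fun w => by
      refine (tsum_of_norm_bounded ((summable_norm_of_l1 w).mul_right C).hasSum
        (hbound w)).trans_eq ?_
      rw [tsum_mul_right, hnorm, mul_comm])
  refine ⟨U, fun s => ?_, LinearMap.mkContinuous_norm_le _ hC _⟩
  change ∑' t, (lp.single 1 s (1 : 𝕜) : ℓ^1(S, 𝕜)) t • x t = x s
  rw [tsum_eq_single s]
  · rw [lp.single_apply_self, one_smul]
  · intro t ht
    rw [lp.single_apply_ne _ _ _ ht, zero_smul]

open Classical in
/-- If the matrix `h_t(x_s)` is unipotent triangular with small entries off the diagonal, then it is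
invertible on `ℓ₁`, and the vectors `x_s` can be recombined into a system biorthogonal to `h`. -/
theorem exists_biorthogonal_lift [CompleteSpace X] {S : Type u} {ι : S → ℕ}
    (hι : Function.Injective ι) {x : S → X} {h : S → StrongDual 𝕜 X} {C : ℝ} (hC : 0 ≤ C)
    (hx : ∀ s, ‖x s‖ ≤ C) (h1 : ∀ t, h t (x t) = 1) (h0 : ∀ t s, ι t < ι s → h t (x s) = 0)
    (hsmall : ∀ t s, ι s < ι t → ‖h t (x s)‖ ≤ 4⁻¹ * (2⁻¹ : ℝ) ^ ι t) :
    ∃ U : ℓ^1(S, 𝕜) →L[𝕜] X, ∀ w t, h t (U w) = w t := by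
  obtain ⟨U₀, hU₀, -⟩ := exists_l1_lift (𝕜 := 𝕜) x hC hx
  have hgeom : Summable fun t : S => 4⁻¹ * (2⁻¹ : ℝ) ^ ι t :=
    ((summable_geometric_of_lt_one (by norm_num) (by norm_num)).comp_injective hι).mul_left _
  have hgeom_le : ∑' t : S, 4⁻¹ * (2⁻¹ : ℝ) ^ ι t ≤ 2⁻¹ := by
    rw [tsum_mul_left]
    have h2 : ∑' t : S, (2⁻¹ : ℝ) ^ ι t ≤ ∑' n : ℕ, (2⁻¹ : ℝ) ^ n :=
      tsum_comp_le_tsum_of_inj (summable_geometric_of_lt_one (by norm_num) (by norm_num))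
        (fun n => by positivity) hι
    rw [tsum_geometric_of_lt_one (by norm_num) (by norm_num)] at h2
    norm_num at h2 ⊢
    linarith
  -- the operator with matrix `h t (x s)` is `1 + N`, where `N` has the columns `n s`
  let n : S → S → 𝕜 := fun s t => if ι s < ι t then h t (x s) else 0
  have hn : ∀ s t, ‖n s t‖ ≤ 4⁻¹ * (2⁻¹ : ℝ) ^ ι t := by
    intro s t
    by_cases hst : ι s < ι t
    · simp only [n, if_pos hst]
      exact hsmall t s hst
    · simp only [n, if_neg hst, norm_zero]
      positivity
  have hnsum : ∀ s, Summable fun t => ‖n s t‖ := fun s =>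
    hgeom.of_nonneg_of_le (fun _ => norm_nonneg _) (hn s)
  have hnmem : ∀ s, Memℓp (n s) 1 := fun s => memℓp_gen (by simpa using hnsum s)
  let N' : S → ℓ^1(S, 𝕜) := fun s => ⟨n s, hnmem s⟩
  have hN' : ∀ s, ‖N' s‖ ≤ 2⁻¹ := by
    intro s
    have h3 : ‖N' s‖ = ∑' t, ‖n s t‖ := by
      simpa using lp.norm_eq_tsum_rpow (p := 1) (by simp) (N' s)
    rw [h3]
    exact ((hnsum s).tsum_le_tsum (hn s) hgeom).trans hgeom_le
  obtain ⟨N, hN, hNnorm⟩ := exists_l1_lift (𝕜 := 𝕜) N' (by norm_num) hN'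
  have hunit : IsUnit (1 - (-N)) := isUnit_one_sub_of_norm_lt_one (by
    rw [norm_neg]
    exact hNnorm.trans_lt (by norm_num))
  obtain ⟨D, hD⟩ := hunit
  have hcoord : ∀ t, (h t) ∘L U₀ =
      (lp.evalCLM 𝕜 (fun _ : S => 𝕜) 1 t) ∘L (D : ℓ^1(S, 𝕜) →L[𝕜] ℓ^1(S, 𝕜)) := by
    intro t
    refine lp.ext_continuousLinearMap ENNReal.one_ne_top fun s => ?_
    ext
    change h t (U₀ (lp.single 1 s (1 : 𝕜))) =
      ((D : ℓ^1(S, 𝕜) →L[𝕜] ℓ^1(S, 𝕜)) (lp.single 1 s (1 : 𝕜))) t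
    have h4 : (D : ℓ^1(S, 𝕜) →L[𝕜] ℓ^1(S, 𝕜)) (lp.single 1 s (1 : 𝕜)) =
        lp.single 1 s (1 : 𝕜) + N' s := by
      rw [hD, sub_neg_eq_add, ← hN]
      rfl
    rw [h4, hU₀]
    change h t (x s) = (lp.single 1 s (1 : 𝕜) : ℓ^1(S, 𝕜)) t + n s t
    rcases lt_trichotomy (ι s) (ι t) with h5 | h5 | h5
    · rw [lp.single_apply_ne _ _ _ (by rintro rfl; exact h5.false)]
      simp [n, h5]
    · obtain rfl := hι h5
      rw [lp.single_apply_self, h1]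
      simp [n]
    · rw [lp.single_apply_ne _ _ _ (by rintro rfl; exact h5.false), h0 t s h5]
      simp [n, h5.not_gt]
  refine ⟨U₀ ∘L ((D⁻¹ : (ℓ^1(S, 𝕜) →L[𝕜] ℓ^1(S, 𝕜))ˣ) : ℓ^1(S, 𝕜) →L[𝕜] ℓ^1(S, 𝕜)),
    fun w t => ?_⟩
  have h6 := DFunLike.congr_fun (hcoord t)
    (((D⁻¹ : (ℓ^1(S, 𝕜) →L[𝕜] ℓ^1(S, 𝕜))ˣ) : ℓ^1(S, 𝕜) →L[𝕜] ℓ^1(S, 𝕜)) w)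
  have h7 : (D : ℓ^1(S, 𝕜) →L[𝕜] ℓ^1(S, 𝕜))
      (((D⁻¹ : (ℓ^1(S, 𝕜) →L[𝕜] ℓ^1(S, 𝕜))ˣ) : ℓ^1(S, 𝕜) →L[𝕜] ℓ^1(S, 𝕜)) w) = w :=
    DFunLike.congr_fun D.mul_inv w
  refine h6.trans ?_
  change ((D : ℓ^1(S, 𝕜) →L[𝕜] ℓ^1(S, 𝕜))
      (((D⁻¹ : (ℓ^1(S, 𝕜) →L[𝕜] ℓ^1(S, 𝕜))ˣ) : ℓ^1(S, 𝕜) →L[𝕜] ℓ^1(S, 𝕜)) w)) t = w t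
  rw [h7]

end Assembly

/-! ### Factoring the summation operator -/

section Factorization

/-- Recursive choice along a numbering: at each index an element is chosen subject to a condition
that involves the elements with a smaller number only. -/
theorem exists_function_of_forall_exists {I A : Type*} [Nonempty A] (ι : I → ℕ)
    (R : I → (I → A) → A → Prop)
    (hcongr : ∀ t F G a, (∀ s, ι s < ι t → F s = G s) → R t F a → R t G a)
    (hex : ∀ t F, (∀ s, ι s < ι t → R s F (F s)) → ∃ a, R t F a) :
    ∃ F : I → A, ∀ t, R t F (F t) := by
  classical
  obtain ⟨a₀⟩ := ‹Nonempty A›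
  let ext : (t : I) → ((s : I) → ι s < ι t → A) → I → A :=
    fun t G s => if h : ι s < ι t then G s h else a₀
  let step : (t : I) → ((s : I) → ι s < ι t → A) → A :=
    fun t G => if h : ∃ a, R t (ext t G) a then h.choose else a₀
  let F : I → A := (measure ι).wf.fix step
  have hF : ∀ t, F t = step t fun s _ => F s := fun t => (measure ι).wf.fix_eq step t
  refine ⟨F, fun t => ?_⟩
  induction hn : ι t using Nat.strong_induction_on generalizing t with
  | _ n ih =>
    subst hn
    obtain ⟨a, ha⟩ := hex t F fun s hs => ih _ hs s rfl
    have hagree : ∀ s, ι s < ι t → F s = ext t (fun s _ => F s) s := fun s hs => by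
      simp only [ext, dif_pos hs]
    have hex' : ∃ a, R t (ext t fun s _ => F s) a := ⟨a, hcongr _ _ _ _ hagree ha⟩
    rw [hF t]
    simp only [step, dif_pos hex']
    exact hcongr _ _ _ _ (fun s hs => (hagree s hs).symm) hex'.choose_spec

variable {𝕜 : Type} [RCLike 𝕜]

/-- A tree of functionals in a set with large derived sets, separated from their predecessors by
an almost biorthogonal system of vectors. -/
theorem exists_tree_system {X : Type u} [NormedAddCommGroup X] [NormedSpace 𝕜 X]
    {K : Set (StrongDual 𝕜 X)} {δ : ℝ} (hδ : 0 < δ) {𝒯 : Type u} [PartialOrder 𝒯]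
    [WellFoundedGT 𝒯] (hc : ∀ t : 𝒯, IsChain (· ≤ ·) (Set.Iic t))
    (hfin : ∀ t : 𝒯, (Set.Iic t).Finite) {ι : 𝒯 → ℕ} (hmono : StrictMono ι)
    (hinj : Function.Injective ι)
    (hK : ∀ ξ < treeRank 𝒯, (iterDeriv (szlenkDeriv δ) K ξ).Nonempty) :
    ∃ (f : 𝒯 → StrongDual 𝕜 X) (x : 𝒯 → X), (∀ t, f t ∈ K) ∧
      ∀ t p, p < t → (∀ r < t, r ≤ p) →
        ‖x t‖ ≤ 16 / δ ∧ (f t - f p) (x t) = 1 ∧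
        ∀ s, ι s < ι t → f s (x t) = 0 ∧ ‖(f t - f p) (x s)‖ ≤ 4⁻¹ * (2⁻¹ : ℝ) ^ ι t := by
  have hearlier : ∀ t : 𝒯, {s | ι s < ι t}.Finite := fun t =>
    (Set.finite_Iio (ι t)).preimage hinj.injOn
  obtain ⟨F, hF⟩ := exists_function_of_forall_exists (A := StrongDual 𝕜 X × X) ι
    (fun t F a => a.1 ∈ iterDeriv (szlenkDeriv δ) K (nodeRank t) ∧
      ∀ p, p < t → (∀ r < t, r ≤ p) →
        ‖a.2‖ ≤ 16 / δ ∧ (a.1 - (F p).1) a.2 = 1 ∧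
        ∀ s, ι s < ι t → (F s).1 a.2 = 0 ∧
          ‖(a.1 - (F p).1) (F s).2‖ ≤ 4⁻¹ * (2⁻¹ : ℝ) ^ ι t)
    (fun t F G a hFG ha => ⟨ha.1, fun p hp hpar => by
      obtain ⟨h1, h2, h3⟩ := ha.2 p hp hpar
      rw [hFG p (hmono hp)] at h2 h3
      refine ⟨h1, h2, fun s hs => ?_⟩
      rw [← hFG s hs]
      exact h3 s hs⟩)
    (fun t F hF => by
      by_cases ht : IsMin t
      · obtain ⟨f, hf⟩ := hK _ (nodeRank_lt_treeRank t)
        exact ⟨(f, 0), hf, fun p hp => absurd hp ht.not_lt⟩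
      · obtain ⟨p, hp, hpar⟩ := exists_parent hc hfin ht
        have hFp : (F p).1 ∈ szlenkDeriv δ (iterDeriv (szlenkDeriv δ) K (nodeRank t)) := by
          rw [← iterDeriv_add_one (szlenkDeriv δ)]
          exact iterDeriv_antitone (szlenkDeriv_subset δ) _
            (Order.add_one_le_of_lt (nodeRank_lt_nodeRank hp)) (hF p (hmono hp)).1
        obtain ⟨U, hU, hpU, h⟩ := exists_isOpen_forall_exists_vector
          ((hearlier t).image fun s => (F s).1) ((hearlier t).image fun s => (F s).2) (F p).1
          (δ := δ / 2) (τ := 4⁻¹ * (2⁻¹ : ℝ) ^ ι t) (by positivity) (by positivity)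
        obtain ⟨g, hg, hgU, hgp⟩ := exists_far_of_mem_szlenkDeriv hFp hU hpU
        obtain ⟨h1, x, hx, hgx, hx0⟩ := h g hgU hgp
        refine ⟨(g, x), hg, fun q hq hq' => ?_⟩
        obtain rfl : q = p := le_antisymm (hpar q hq) (hq' p hp)
        refine ⟨hx.trans_eq (by field_simp; norm_num), hgx, fun s hs => ?_⟩
        exact ⟨hx0 _ (Set.mem_image_of_mem _ hs), h1 _ (Set.mem_image_of_mem _ hs)⟩)
  exact ⟨fun t => (F t).1, fun t => (F t).2,
    fun t => iterDeriv_subset (szlenkDeriv_subset δ) _ _ (hF t).1, fun t => (hF t).2⟩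

theorem summationOperator_factorsThrough {T : BanachOperator.{u} 𝕜} {δ : ℝ} (hδ : 0 < δ)
    {𝒯 : Type u} [PartialOrder 𝒯] [Countable 𝒯] [Nonempty 𝒯] [WellFoundedGT 𝒯]
    (hc : ∀ t : 𝒯, IsChain (· ≤ ·) (Set.Iic t)) (hfin : ∀ t : 𝒯, (Set.Iic t).Finite)
    (hroot : IsRooted 𝒯)
    (hT : ∀ ξ < treeRank 𝒯, (iterDeriv (szlenkDeriv δ) T.dualBall ξ).Nonempty) :
    (summationOperator 𝕜 (Star 𝒯)).FactorsThrough T := by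
  obtain ⟨ι, hmono, hinj⟩ := exists_strictMono_injective_nat hfin
  obtain ⟨f, x, hf, hfx⟩ := exists_tree_system hδ hc hfin hmono hinj hT
  obtain ⟨root, -, hmin⟩ := exists_isMin_le hfin (Classical.arbitrary 𝒯)
  choose p hp hpar using fun t : Star 𝒯 => exists_parent hc hfin t.2
  choose y hy hyf using hf
  have hy' : ∀ t, ‖y t‖ ≤ 1 := fun t => mem_closedBall_zero_iff.1 (hy t)
  obtain ⟨U, hU⟩ := exists_biorthogonal_lift (𝕜 := 𝕜) (S := Star 𝒯) (ι := fun t => ι t)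
    (hinj.comp Subtype.val_injective) (x := fun t => x t) (h := fun t => f t - f (p t))
    (C := 16 / δ) (by positivity) (fun t => (hfx t _ (hp t) (hpar t)).1)
    (fun t => (hfx t _ (hp t) (hpar t)).2.1)
    (fun t s hts => by
      have h1 := (hfx s _ (hp s) (hpar s)).2.2
      rw [sub_apply, (h1 t hts).1, (h1 (p t) ((hmono (hp t)).trans hts)).1, sub_zero])
    (fun t s hst => ((hfx t _ (hp t) (hpar t)).2.2 s hst).2)
  -- the increments of `f` along the path to `t` telescope
  have hpath : ∀ t w, (f t - f root) (U w) = pathFunctional 𝕜 t w := by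
    intro t w
    induction hn : ι t using Nat.strong_induction_on generalizing t with
    | _ n ih =>
      subst hn
      by_cases ht : IsMin t
      · rw [hroot ht hmin, pathFunctional_of_isMin hmin, sub_self]
        rfl
      · have h1 := ih _ (hmono (hp ⟨t, ht⟩)) (p ⟨t, ht⟩) rfl
        have h2 := hU w ⟨t, ht⟩
        rw [pathFunctional_eq_add (s := ⟨t, ht⟩) (hp ⟨t, ht⟩) (hpar ⟨t, ht⟩), ← h1, ← h2]
        simp
  have hbound : ∀ (v : T.Cod) (t : Star 𝒯), ‖(y t - y root) v‖ ≤ 2 * ‖v‖ := by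
    intro v t
    refine ((y t - y root).le_opNorm v).trans ?_
    gcongr
    calc ‖y t - y root‖ ≤ ‖y t‖ + ‖y root‖ := norm_sub_le _ _
      _ ≤ 2 := by linarith [hy' t, hy' root]
  -- subtracting the functional of the root removes the contribution of the root
  let V : T.Cod →L[𝕜] ℓ^∞(Star 𝒯, 𝕜) := LinearMap.mkContinuous
    { toFun := fun v => ⟨fun t => (y t - y root) v, memℓp_infty ⟨2 * ‖v‖, by
          rintro _ ⟨t, rfl⟩
          exact hbound v t⟩⟩
      map_add' := fun v w => lp.ext (funext fun t => map_add (y t - y root) v w)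
      map_smul' := fun c v => lp.ext (funext fun t => map_smul (y t - y root) c v) }
    2 (fun v => lp.norm_le_of_forall_le (by positivity) fun t => hbound v t)
  have hVTU : ∀ (w : ℓ^1(Star 𝒯, 𝕜)) (t : Star 𝒯),
      (y t - y root) (T.op (U w)) = summation 𝕜 (Star 𝒯) w t := fun w t => by
    rw [← pathFunctional_coe, ← hpath, ← hyf, ← hyf]
    rfl
  exact ⟨U, V, ContinuousLinearMap.ext fun w => lp.ext (funext fun t => hVTU w t)⟩

theorem summationOperator_factorsThrough_of_not_mem_SZ {T : BanachOperator.{u} 𝕜}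
    {α : Ordinal.{u}} (hT : T ∉ SZ 𝕜 α) {𝒯 : Type u} [PartialOrder 𝒯] [Countable 𝒯]
    [Nonempty 𝒯] (htree : IsTree 𝒯) (hroot : IsRooted 𝒯) (hwf : IsWellFoundedTree 𝒯)
    (hrank : treeRank 𝒯 < ω ^ (α + 1)) :
    (summationOperator 𝕜 (Star 𝒯)).FactorsThrough T := by
  have := hwf.wellFoundedGT
  obtain ⟨n, hn⟩ := Ordinal.lt_omega0_opow_succ.1 (by simpa using hrank)
  obtain ⟨δ, hδ, h0⟩ := exists_zero_mem_iterDeriv_mul hT n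
  exact summationOperator_factorsThrough hδ htree.isChain_Iic
    (fun t => hwf.finite_of_isChain (htree.isChain_Iic t)) hroot fun ξ hξ =>
    ⟨0, iterDeriv_antitone (szlenkDeriv_subset δ) _ (hξ.trans hn).le h0⟩

end Factorization

/-! ### Trees of prescribed rank -/

section ListTree

variable {I : Type u}

/-- The ordinal reached from `a` by following a list of labels (read from its last entry to its
first), where the label `i` leads from `b` to `c b i`. -/
def listState (c : Ordinal.{u} → I → Ordinal.{u}) (a : Ordinal.{u}) : List I → Ordinal.{u}
  | [] => a
  | i :: l => c (listState c a l) i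

/-- A list of labels is admissible if no label is read at the ordinal `0`. -/
def ListAdmissible (c : Ordinal.{u} → I → Ordinal.{u}) (a : Ordinal.{u}) : List I → Prop
  | [] => True
  | _ :: l => ListAdmissible c a l ∧ 0 < listState c a l

theorem ListAdmissible.exists_cons_suffix {c : Ordinal.{u} → I → Ordinal.{u}} {a : Ordinal.{u}}
    {k l : List I} (hl : ListAdmissible c a l) (h : k <:+ l) (hne : k ≠ l) :
    0 < listState c a k ∧ ∃ i, i :: k <:+ l := by
  induction l with
  | nil => exact absurd (List.suffix_nil.1 h) hne
  | cons j l ih =>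
    have h1 : k <:+ l := (List.suffix_cons_iff.1 h).resolve_left hne
    by_cases h2 : k = l
    · subst h2
      exact ⟨hl.2, j, List.suffix_refl _⟩
    · obtain ⟨h3, i, hi⟩ := ih hl.1 h1 h2
      exact ⟨h3, i, hi.trans (List.suffix_cons j l)⟩

theorem ListAdmissible.listState_le {c : Ordinal.{u} → I → Ordinal.{u}} {a : Ordinal.{u}}
    (hlt : ∀ b, 0 < b → ∀ i, c b i < b) {k l : List I} (hl : ListAdmissible c a l)
    (h : k <:+ l) : listState c a l ≤ listState c a k := by
  induction l with
  | nil => rw [List.suffix_nil.1 h]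
  | cons j l ih =>
    rcases List.suffix_cons_iff.1 h with rfl | h1
    · rfl
    · exact (hlt _ hl.2 j).le.trans (ih hl.1 h1)

/-- The tree of admissible lists of labels, ordered by the suffix relation: the immediate
successors of a list arise by adding a label in front. -/
@[ext]
structure ListTree (c : Ordinal.{u} → I → Ordinal.{u}) (a : Ordinal.{u}) : Type u where
  /-- the list of labels, the most recent one first -/
  labels : List I
  /-- the ordinal `0` is reached at the end only -/
  admissible : ListAdmissible c a labels

namespace ListTree

variable {c : Ordinal.{u} → I → Ordinal.{u}} {a : Ordinal.{u}}

instance : PartialOrder (ListTree c a) where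
  le s t := s.labels <:+ t.labels
  le_refl s := List.suffix_refl _
  le_trans _ _ _ h h' := h.trans h'
  le_antisymm s t h h' := ListTree.ext (h.eq_of_length_le h'.length_le)

/-- The ordinal reached at a node. -/
def state (t : ListTree c a) : Ordinal.{u} := listState c a t.labels

/-- The empty list. -/
def root : ListTree c a := ⟨[], trivial⟩

/-- The node obtained by adding a label in front. -/
def child (t : ListTree c a) (ht : 0 < t.state) (i : I) : ListTree c a :=
  ⟨i :: t.labels, t.admissible, ht⟩

theorem child_injective (t : ListTree c a) (ht : 0 < t.state) :
    Function.Injective (t.child ht) := fun _ _ h =>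
  (List.cons.inj (congrArg labels h)).1

theorem lt_child (t : ListTree c a) (ht : 0 < t.state) (i : I) : t < t.child ht i := by
  refine lt_of_le_of_ne (List.suffix_cons _ _) fun h => ?_
  exact List.cons_ne_self _ _ (congrArg labels h).symm

theorem exists_child_le {s t : ListTree c a} (h : s < t) :
    ∃ (hs : 0 < s.state) (i : I), s.child hs i ≤ t := by
  obtain ⟨hs, i, hi⟩ := t.admissible.exists_cons_suffix h.le fun h1 => h.ne (ListTree.ext h1)
  exact ⟨hs, i, hi⟩

theorem root_le (t : ListTree c a) : root ≤ t := List.nil_suffix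

theorem isChain_Iic (t : ListTree c a) : IsChain (· ≤ ·) (Set.Iic t) :=
  fun _ hr _ hs _ => List.suffix_or_suffix_of_suffix hr hs

theorem finite_Iic (t : ListTree c a) : (Set.Iic t).Finite := by
  have h : Function.Injective (labels (c := c) (a := a)) := fun s t h => ListTree.ext h
  refine ((List.finite_toSet t.labels.tails).preimage h.injOn).subset fun s hs => ?_
  exact (List.mem_tails _ _).2 hs

theorem isTree : IsTree (ListTree c a) := by
  intro t
  have := (finite_Iic t).to_subtype
  have htri : Std.Trichotomous (α := Set.Iic t) (· < ·) := ⟨fun r s h h' => by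
    rcases (isChain_Iic t).total r.2 s.2 with h1 | h1
    · exact (Subtype.coe_le_coe.1 h1).eq_of_not_lt h
    · exact ((Subtype.coe_le_coe.1 h1).eq_of_not_lt h').symm⟩
  exact { wf := Finite.wellFounded_of_trans_of_irrefl _ }

theorem isRooted : IsRooted (ListTree c a) := fun _ hs _ ht =>
  (le_antisymm (hs (root_le _)) (root_le _)).trans (le_antisymm (ht (root_le _)) (root_le _)).symm

instance [Countable I] : Countable (ListTree c a) :=
  Function.Injective.countable (f := labels) fun _ _ h => ListTree.ext h

theorem mem_immSucc_iff {s t : ListTree c a} :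
    s ∈ immSucc t ↔ ∃ (ht : 0 < t.state) (i : I), t.child ht i = s := by
  constructor
  · intro hs
    obtain ⟨ht, i, h⟩ := exists_child_le hs.1
    exact ⟨ht, i, le_antisymm h (hs.2 (lt_child t ht i) h)⟩
  · rintro ⟨ht, i, rfl⟩
    refine ⟨lt_child t ht i, fun r hr hri => ?_⟩
    obtain ⟨_, j, hj⟩ := exists_child_le hr
    have h1 := hj.trans hri
    have h2 : t.child ht j = t.child ht i := ListTree.ext (List.IsSuffix.eq_of_length h1 rfl)
    rwa [← h2]

theorem strictAnti_state (hlt : ∀ b, 0 < b → ∀ i, c b i < b) :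
    StrictAnti (state (c := c) (a := a)) := by
  intro s t h
  obtain ⟨hs, i, hi⟩ := exists_child_le h
  exact (t.admissible.listState_le hlt hi).trans_lt (hlt _ hs i)

theorem wellFoundedGT (hlt : ∀ b, 0 < b → ∀ i, c b i < b) :
    WellFoundedGT (ListTree c a) :=
  (strictAnti_state hlt).wellFoundedGT

theorem isWellFoundedTree (hlt : ∀ b, 0 < b → ∀ i, c b i < b) :
    IsWellFoundedTree (ListTree c a) := by
  have := wellFoundedGT (a := a) hlt
  intro B hB
  rcases B.eq_empty_or_nonempty with rfl | hne
  · exact Set.finite_empty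
  · obtain ⟨m, hm, hmax⟩ := WellFounded.has_min (wellFounded_gt (α := ListTree c a)) B hne
    refine (finite_Iic m).subset fun t ht => ?_
    rcases hB.1.total ht hm with h | h
    · exact h
    · exact (h.eq_or_lt.resolve_right (hmax t ht)).ge

theorem state_le (hlt : ∀ b, 0 < b → ∀ i, c b i < b) (t : ListTree c a) : t.state ≤ a :=
  (strictAnti_state hlt).antitone (root_le t)

theorem exists_lt_le_state (hlt : ∀ b, 0 < b → ∀ i, c b i < b)
    (hcof : ∀ b ≤ a, ∀ ξ < b, ∃ i, ξ ≤ c b i) (t : ListTree c a) (ξ : Ordinal.{u})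
    (hξ : ξ < t.state) :
    ∃ s, t < s ∧ ξ ≤ s.state := by
  obtain ⟨i, hi⟩ := hcof _ (state_le hlt t) ξ hξ
  exact ⟨t.child (zero_le.trans_lt hξ) i, lt_child _ _ _, hi⟩

theorem mem_derivedTree (hlt : ∀ b, 0 < b → ∀ i, c b i < b)
    (hcof : ∀ b ≤ a, ∀ ξ < b, ∃ i, ξ ≤ c b i) {t : ListTree c a}
    {ξ : Ordinal.{u}} : t ∈ derivedTree (ListTree c a) ξ ↔ ξ ≤ t.state :=
  mem_derivedTree_iff_of_rank (strictAnti_state hlt) (exists_lt_le_state hlt hcof)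

theorem nodeRank_eq (hlt : ∀ b, 0 < b → ∀ i, c b i < b)
    (hcof : ∀ b ≤ a, ∀ ξ < b, ∃ i, ξ ≤ c b i) (t : ListTree c a) : nodeRank t = t.state :=
  nodeRank_eq_of_rank (strictAnti_state hlt) (exists_lt_le_state hlt hcof) t

theorem treeRank_eq (hlt : ∀ b, 0 < b → ∀ i, c b i < b)
    (hcof : ∀ b ≤ a, ∀ ξ < b, ∃ i, ξ ≤ c b i) : treeRank (ListTree c a) = a + 1 := by
  have := wellFoundedGT (a := a) hlt
  refine le_antisymm (csInf_le' ?_) ?_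
  · refine Set.eq_empty_iff_forall_notMem.2 fun t ht => ?_
    have h1 := (mem_derivedTree hlt hcof).1 ht
    exact (Order.lt_add_one_iff.2 (state_le hlt t)).not_ge h1
  · have h1 := nodeRank_lt_treeRank (root : ListTree c a)
    rw [nodeRank_eq hlt hcof] at h1
    exact Order.add_one_le_of_lt h1

theorem infinite_immSucc (hlt : ∀ b, 0 < b → ∀ i, c b i < b)
    (hinf : ∀ b ≤ a, ∀ ξ < b, {i | ξ ≤ c b i}.Infinite) (t : ListTree c a) (ξ : Ordinal.{u})
    (ht : t ∈ derivedTree (ListTree c a) (ξ + 1)) :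
    {s ∈ immSucc t | s ∈ derivedTree (ListTree c a) ξ}.Infinite := by
  have hcof : ∀ b ≤ a, ∀ ξ < b, ∃ i, ξ ≤ c b i := fun b hb ξ hξ => (hinf b hb ξ hξ).nonempty
  have h1 : ξ < t.state := Order.add_one_le_iff.1 ((mem_derivedTree hlt hcof).1 ht)
  have h0 : 0 < t.state := zero_le.trans_lt h1
  refine ((hinf _ (state_le hlt t) ξ h1).image (child_injective t h0).injOn).mono ?_
  rintro _ ⟨i, hi, rfl⟩
  exact ⟨mem_immSucc_iff.2 ⟨h0, i, rfl⟩, (mem_derivedTree hlt hcof).2 hi⟩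

end ListTree

/-- A countable nonzero ordinal is the limit of a non-decreasing sequence, in the sense suited to
ranks: for a successor the sequence reaches the predecessor. -/
theorem exists_monotone_cofinal {b : Ordinal.{u}} (hb : b < ω_ 1) (h0 : 0 < b) :
    ∃ f : ℕ → Ordinal.{u}, Monotone f ∧ (∀ n, f n < b) ∧ ∀ ξ < b, ∃ n, ξ ≤ f n := by
  have : Countable (Set.Iio b) := by
    rw [← Cardinal.mk_le_aleph0_iff, Cardinal.mk_Iio_ordinal,
      Cardinal.lift_le_aleph0, ← Cardinal.lt_aleph_one_iff]
    exact Cardinal.lt_omega_iff_card_lt.1 hb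
  have : Nonempty (Set.Iio b) := ⟨0, h0⟩
  obtain ⟨g, hg⟩ := exists_surjective_nat (Set.Iio b)
  refine ⟨fun n => partialSups (fun k => (g k : Ordinal.{u})) n,
    fun m n h => (partialSups _).monotone h, fun n => ?_, fun ξ hξ => ?_⟩
  · exact (partialSups_iff_forall (· < b) max_lt_iff).2 fun k _ => (g k).2
  · obtain ⟨n, hn⟩ := hg ⟨ξ, hξ⟩
    refine ⟨n, ?_⟩
    have h1 : (g n : Ordinal.{u}) ≤ partialSups (fun k => (g k : Ordinal.{u})) n :=
      le_partialSups (fun k => (g k : Ordinal.{u})) n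
    rwa [hn] at h1

/-- For a nonzero countable ordinal `a` there is an infinite blossomed tree of rank `a + 1`. -/
theorem exists_isBlossomed {a : Ordinal.{u}} (ha : a < ω_ 1) (h0 : 0 < a) :
    ∃ (𝒯 : Type u) (_ : PartialOrder 𝒯), IsBlossomed 𝒯 ∧ Infinite 𝒯 ∧ treeRank 𝒯 = a + 1 := by
  classical
  have hex : ∀ b : Ordinal.{u}, ∃ f : ℕ → Ordinal.{u}, Monotone f ∧ (0 < b → ∀ n, f n < b) ∧
      (b ≤ a → ∀ ξ < b, ∃ n, ξ ≤ f n) := by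
    intro b
    by_cases hb : 0 < b ∧ b < ω_ 1
    · obtain ⟨f, hf, hf', hf''⟩ := exists_monotone_cofinal hb.2 hb.1
      exact ⟨f, hf, fun _ => hf', fun _ => hf''⟩
    · refine ⟨fun _ => 0, monotone_const, fun h _ => h, fun hba ξ hξ => ?_⟩
      exact absurd ⟨zero_le.trans_lt hξ, hba.trans_lt ha⟩ hb
  choose f hf hlt hcof using hex
  let c : Ordinal.{u} → ULift.{u} ℕ → Ordinal.{u} := fun b n => f b n.down
  have hlt' : ∀ b, 0 < b → ∀ i, c b i < b := fun b hb i => hlt b hb i.down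
  have hcof' : ∀ b ≤ a, ∀ ξ < b, ∃ i, ξ ≤ c b i := fun b hb ξ hξ => by
    obtain ⟨n, hn⟩ := hcof b hb ξ hξ
    exact ⟨⟨n⟩, hn⟩
  refine ⟨ListTree c a, inferInstance, ⟨ListTree.isTree, inferInstance, ListTree.isRooted,
    ListTree.isWellFoundedTree hlt', fun t ht => ?_⟩, ?_, ListTree.treeRank_eq hlt' hcof'⟩
  · obtain ⟨s, hs⟩ := not_isMax_iff.1 ht
    obtain ⟨h0, -, -⟩ := ListTree.exists_child_le hs
    let ψ : ℕ → immSucc t := fun n => ⟨t.child h0 ⟨n⟩, ListTree.mem_immSucc_iff.2 ⟨h0, _, rfl⟩⟩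
    have hψ : Function.Bijective ψ := by
      constructor
      · intro m n h
        exact congrArg ULift.down (ListTree.child_injective t h0 (congrArg Subtype.val h))
      · rintro ⟨s, hs⟩
        obtain ⟨_, i, rfl⟩ := ListTree.mem_immSucc_iff.1 hs
        exact ⟨i.down, rfl⟩
    refine ⟨Equiv.ofBijective ψ hψ, fun m n h => ?_⟩
    rw [ListTree.nodeRank_eq hlt' hcof', ListTree.nodeRank_eq hlt' hcof']
    exact hf _ h
  · exact Infinite.of_injective _
      (ListTree.child_injective (ListTree.root (c := c) (a := a)) h0)

/-- For every ordinal there is a well-founded tree whose summation operator has a larger Szlenk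
index. -/
theorem exists_wellFounded_not_mem_SZ (𝕜 : Type) [RCLike 𝕜] (β : Ordinal.{u}) :
    ∃ (𝒯 : Type u) (_ : PartialOrder 𝒯), (∀ t : 𝒯, IsChain (· ≤ ·) (Set.Iic t)) ∧
      (∀ t : 𝒯, (Set.Iic t).Finite) ∧ WellFoundedGT 𝒯 ∧
      summationOperator 𝕜 (Star 𝒯) ∉ SZ 𝕜 β := by
  classical
  let a : Ordinal.{u} := ω ^ β
  let c : Ordinal.{u} → a.ToType × ℕ → Ordinal.{u} := fun b i =>
    if (i.1.toOrd : Ordinal.{u}) < b then i.1.toOrd else 0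
  have hlt : ∀ b, 0 < b → ∀ i, c b i < b := by
    intro b hb i
    simp only [c]
    split_ifs with h
    · exact h
    · exact hb
  have hinf : ∀ b ≤ a, ∀ ξ < b, {i | ξ ≤ c b i}.Infinite := by
    intro b hb ξ hξ
    have h1 : Function.Injective fun n : ℕ =>
        ((Ordinal.ToType.mk ⟨ξ, hξ.trans_le hb⟩, n) : a.ToType × ℕ) :=
      fun m n h => congrArg Prod.snd h
    refine (Set.infinite_range_of_injective h1).mono ?_
    rintro _ ⟨n, rfl⟩
    simp [c, hξ]
  have hcof : ∀ b ≤ a, ∀ ξ < b, ∃ i, ξ ≤ c b i := fun b hb ξ hξ => (hinf b hb ξ hξ).nonempty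
  refine ⟨ListTree c a, inferInstance, ListTree.isChain_Iic, ListTree.finite_Iic,
    ListTree.wellFoundedGT hlt, ?_⟩
  exact summationOperator_not_mem_SZ ListTree.isChain_Iic (ListTree.infinite_immSucc hlt hinf)
    ⟨ListTree.root, (ListTree.mem_derivedTree hlt hcof).2 le_rfl⟩

/-- For the infinitely branching tree of height `ω` no derived set is empty, so that the Szlenk
index of the summation operator is undefined. -/
theorem exists_countable_not_mem_SZ (𝕜 : Type) [RCLike 𝕜] :
    ∃ (𝒯 : Type u) (_ : PartialOrder 𝒯), Countable 𝒯 ∧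
      ∀ β : Ordinal.{u}, summationOperator 𝕜 (Star 𝒯) ∉ SZ 𝕜 β := by
  let c : Ordinal.{u} → ULift.{u} ℕ → Ordinal.{u} := fun _ _ => 1
  have hpos : ∀ t : ListTree c 1, 0 < t.state := fun t => by
    obtain ⟨l, hl⟩ := t
    cases l <;> exact zero_lt_one
  have huniv : ∀ (ξ : Ordinal.{u}) (t : ListTree c 1), t ∈ derivedTree (ListTree c 1) ξ := by
    intro ξ
    induction ξ using Ordinal.limitRecOn with
    | zero => simp [derivedTree_zero]
    | add_one ξ ih =>
      exact fun t => mem_derivedTree_add_one.2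
        ⟨t.child (hpos t) ⟨0⟩, ih _, ListTree.lt_child _ _ _⟩
    | limit ξ hξ ih => exact fun t => (mem_derivedTree_limit hξ).2 fun ζ hζ => ih ζ hζ t
  refine ⟨ListTree c 1, inferInstance, inferInstance, fun β =>
    summationOperator_not_mem_SZ ListTree.isChain_Iic (fun t ξ _ => ?_)
      ⟨ListTree.root, huniv _ _⟩⟩
  refine (Set.infinite_range_of_injective (ListTree.child_injective t (hpos t))).mono ?_
  rintro _ ⟨i, rfl⟩
  exact ⟨ListTree.mem_immSucc_iff.2 ⟨hpos t, i, rfl⟩, huniv _ _⟩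

end ListTree

/-! ### Operators through a separable `ℓ₁` space -/

section Stabilization

theorem exists_lt_omega_one_subset_add_one {Y : Type*} [TopologicalSpace Y]
    [SecondCountableTopology Y] {C : Ordinal.{u} → Set Y} (hC : Antitone C)
    (hclosed : ∀ ξ, IsClosed (C ξ)) : ∃ ξ < (ω_ 1 : Ordinal.{u}), C ξ ⊆ C (ξ + 1) := by
  obtain ⟨T, hT, hTc, hU⟩ := TopologicalSpace.isOpen_biUnion_countable
    (Set.Iio (ω_ 1 : Ordinal.{u})) (fun ξ => (C ξ)ᶜ) fun ξ _ => (hclosed ξ).isOpen_compl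
  have : Countable T := hTc.to_subtype
  have hlt : ⨆ ξ : T, (ξ : Ordinal.{u}) < ω_ 1 := Ordinal.iSup_lt_omega_one fun ξ => hT ξ.2
  have hlim : Order.IsSuccLimit (ω_ 1 : Ordinal.{u}) := Cardinal.isSuccLimit_omega 1
  refine ⟨_, hlt, fun y hy => ?_⟩
  by_contra hy'
  have h1 : y ∈ ⋃ ξ ∈ T, (C ξ)ᶜ := by
    rw [hU]
    exact Set.mem_biUnion (hlim.add_one_lt hlt) hy'
  obtain ⟨ξ, hξ, hyξ⟩ := Set.mem_iUnion₂.1 h1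
  exact hyξ (hC (Ordinal.le_iSup (fun ξ : T => (ξ : Ordinal.{u})) ⟨ξ, hξ⟩) hy)

variable {𝕜 : Type} [RCLike 𝕜]

theorem continuous_weakDual_comp {E F : Type*} [NormedAddCommGroup E] [NormedSpace 𝕜 E]
    [NormedAddCommGroup F] [NormedSpace 𝕜 F] (A : E →L[𝕜] F) :
    Continuous fun g : WeakDual 𝕜 F =>
      StrongDual.toWeakDual (WeakDual.toStrongDual g ∘L A : StrongDual 𝕜 E) :=
  WeakDual.continuous_of_continuous_eval fun x => WeakDual.eval_continuous (A x)

theorem toWeakDual_image_dualBall (T : BanachOperator.{u} 𝕜) :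
    (StrongDual.toWeakDual '' T.dualBall : Set (WeakDual 𝕜 T.Dom)) =
      (fun g : WeakDual 𝕜 T.Cod =>
        StrongDual.toWeakDual (WeakDual.toStrongDual g ∘L T.op : StrongDual 𝕜 T.Dom)) ''
      (WeakDual.toStrongDual ⁻¹' Metric.closedBall 0 1) := by
  ext f
  constructor
  · rintro ⟨_, ⟨g, hg, rfl⟩, rfl⟩
    exact ⟨StrongDual.toWeakDual g, hg, rfl⟩
  · rintro ⟨g, hg, rfl⟩
    exact ⟨_, ⟨WeakDual.toStrongDual g, hg, rfl⟩, rfl⟩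

theorem isClosed_dualBall (T : BanachOperator.{u} 𝕜) :
    IsClosed (StrongDual.toWeakDual '' T.dualBall : Set (WeakDual 𝕜 T.Dom)) := by
  rw [toWeakDual_image_dualBall]
  exact ((WeakDual.isCompact_closedBall 0 1).image (continuous_weakDual_comp T.op)).isClosed

/-- The functionals in the dual unit ball whose images under the adjoint of `T` lie in `F`. -/
def BanachOperator.adjointPreimage (T : BanachOperator.{u} 𝕜) (F : Set (StrongDual 𝕜 T.Dom)) :
    Set (WeakDual 𝕜 T.Cod) :=
  {g | WeakDual.toStrongDual g ∈ Metric.closedBall (0 : StrongDual 𝕜 T.Cod) 1 ∧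
    (WeakDual.toStrongDual g ∘L T.op : StrongDual 𝕜 T.Dom) ∈ F}

theorem isCompact_adjointPreimage (T : BanachOperator.{u} 𝕜) {F : Set (StrongDual 𝕜 T.Dom)}
    (hF : IsClosed (StrongDual.toWeakDual '' F : Set (WeakDual 𝕜 T.Dom))) :
    IsCompact (T.adjointPreimage F) := by
  have h1 : T.adjointPreimage F = (WeakDual.toStrongDual ⁻¹' Metric.closedBall 0 1) ∩
      (fun g : WeakDual 𝕜 T.Cod =>
        StrongDual.toWeakDual (WeakDual.toStrongDual g ∘L T.op : StrongDual 𝕜 T.Dom)) ⁻¹'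
      (StrongDual.toWeakDual '' F) := by
    ext g
    refine and_congr Iff.rfl ?_
    constructor
    · exact fun h => ⟨_, h, rfl⟩
    · rintro ⟨f, hf, hfg⟩
      rwa [StrongDual.toWeakDual.injective hfg] at hf
  rw [h1]
  exact (WeakDual.isCompact_closedBall 0 1).inter_right
    (hF.preimage (continuous_weakDual_comp T.op))

/-- If `T` factors through `ℓ₁` of a countable set, then the derived sets of `T*(B_{Y*})` stabilize
before `ω₁`: they are determined by closed subsets of a second-countable space. -/
theorem exists_derived_stable {T : BanachOperator.{u} 𝕜} {S : Type u} [Countable S]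
    (U : T.Dom →L[𝕜] ℓ^1(S, 𝕜)) (V : ℓ^1(S, 𝕜) →L[𝕜] T.Cod) (hVU : V ∘L U = T.op) (ε : ℝ) :
    ∃ ξ < (ω_ 1 : Ordinal.{u}), iterDeriv (szlenkDeriv ε) T.dualBall ξ ⊆
      szlenkDeriv ε (iterDeriv (szlenkDeriv ε) T.dualBall ξ) := by
  classical
  let q : WeakDual 𝕜 T.Cod → S → 𝕜 := fun g s => g (V (lp.single 1 s (1 : 𝕜)))
  have hq : Continuous q := continuous_pi fun s => WeakDual.eval_continuous _
  have hqT : ∀ g g' : WeakDual 𝕜 T.Cod, q g = q g' →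
      (WeakDual.toStrongDual g ∘L T.op : StrongDual 𝕜 T.Dom) =
        WeakDual.toStrongDual g' ∘L T.op := by
    intro g g' h
    have h1 : (WeakDual.toStrongDual g) ∘L V = (WeakDual.toStrongDual g') ∘L V := by
      refine lp.ext_continuousLinearMap ENNReal.one_ne_top fun s => ?_
      ext
      exact congrFun h s
    rw [← hVU]
    ext x
    exact DFunLike.congr_fun h1 (U x)
  obtain ⟨ξ, hξ, h⟩ := exists_lt_omega_one_subset_add_one
    (C := fun ξ => q '' T.adjointPreimage (iterDeriv (szlenkDeriv ε) T.dualBall ξ))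
    (fun ξ ζ hξζ => Set.image_mono fun g hg =>
      ⟨hg.1, iterDeriv_antitone (szlenkDeriv_subset ε) _ hξζ hg.2⟩)
    (fun ξ => ((isCompact_adjointPreimage T
      (isClosed_iterDeriv_szlenkDeriv (isClosed_dualBall T) ξ)).image hq).isClosed)
  refine ⟨ξ, hξ, fun f hf => ?_⟩
  rw [← iterDeriv_add_one (szlenkDeriv ε)]
  obtain ⟨g, hg, rfl⟩ := iterDeriv_subset (szlenkDeriv_subset ε) _ _ hf
  obtain ⟨g', hg', hgg'⟩ := h ⟨StrongDual.toWeakDual g, ⟨hg, hf⟩, rfl⟩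
  have h2 := hqT _ _ hgg'
  have h3 := hg'.2
  rw [h2] at h3
  exact h3

end Stabilization

/-! ### Fragmentability of the dual balls of well-founded trees -/

section Fragmentability

variable {𝕜 : Type} [RCLike 𝕜]

open Classical in
theorem norm_le_of_norm_single_le {S : Type u} (f : StrongDual 𝕜 ℓ^1(S, 𝕜)) {C : ℝ} (hC : 0 ≤ C)
    (h : ∀ s, ‖f (lp.single 1 s (1 : 𝕜))‖ ≤ C) : ‖f‖ ≤ C := by
  let x : S → 𝕜 := fun s => f (lp.single 1 s (1 : 𝕜))
  obtain ⟨g, hg, hgC⟩ := exists_l1_lift (𝕜 := 𝕜) x hC h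
  have : f = g := by
    refine lp.ext_continuousLinearMap ENNReal.one_ne_top fun s => ?_
    ext
    exact (hg s).symm
  rwa [this]

open Classical in
theorem summation_single {S : Type u} [PartialOrder S] (s t : S) :
    summation 𝕜 S (lp.single 1 s (1 : 𝕜)) t = if s ≤ t then 1 else 0 := by
  rw [summation_apply]
  split_ifs with h
  · rw [tsum_eq_single ⟨s, h⟩]
    · exact lp.single_apply_self ..
    · intro r hr
      exact lp.single_apply_ne _ _ _ fun h1 => hr (Subtype.ext h1)
  · rw [← tsum_zero]
    refine tsum_congr fun r => lp.single_apply_ne _ _ _ ?_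
    rintro rfl
    exact h r.2

/-- An infinite set of nodes of a well-founded tree contains an infinite antichain. -/
theorem exists_antichain_seq {S : Type u} [PartialOrder S] [WellFoundedGT S]
    (hfin : ∀ t : S, (Set.Iic t).Finite) {A : Set S} (hA : A.Infinite) :
    ∃ a : ℕ → S, (∀ n, a n ∈ A) ∧ ∀ m n, m ≠ n → ¬ a m ≤ a n := by
  obtain ⟨e, he⟩ : ∃ e : ℕ → S, Function.Injective e ∧ ∀ n, e n ∈ A :=
    ⟨fun n => hA.natEmbedding A n, Subtype.val_injective.comp (hA.natEmbedding A).injective,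
      fun n => (hA.natEmbedding A n).2⟩
  obtain ⟨g, hg | hg⟩ := exists_increasing_or_nonincreasing_subseq (· < ·) e
  · exact ((RelEmbedding.wellFounded_iff_isEmpty.1 (wellFounded_gt (α := S))).false
      (RelEmbedding.natGT (r := ((· > ·) : S → S → Prop)) (fun n => e (g n))
        fun n => hg n (n + 1) n.lt_succ_self)).elim
  obtain ⟨k, hk | hk⟩ := exists_increasing_or_nonincreasing_subseq (· > ·) (e ∘ g)
  · have hinj : Function.Injective fun n => e (g (k n)) :=
      he.1.comp (g.injective.comp k.injective)
    refine absurd (hfin (e (g (k 0)))) (Set.Infinite.mono ?_ (Set.infinite_range_of_injective hinj))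
    rintro _ ⟨n, rfl⟩
    rcases n.eq_zero_or_pos with rfl | hn
    · exact le_rfl
    · exact (hk 0 n hn).le
  refine ⟨fun n => e (g (k n)), fun n => he.2 _, fun m n hmn hle => ?_⟩
  have hlt : e (g (k m)) < e (g (k n)) := hle.lt_of_ne fun h =>
    hmn (k.injective (g.injective (he.1 h)))
  rcases hmn.lt_or_gt with h | h
  · exact hg _ _ (k.strictMono h) hlt
  · exact hk _ _ h hlt

open Classical in
/-- The adjoint of the summation operator of a well-founded tree takes values in `c₀`: the sets
of successors of the nodes of an antichain are disjoint. -/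
theorem finite_setOf_lt_norm_summation {S : Type u} [PartialOrder S] [WellFoundedGT S]
    (hc : ∀ t : S, IsChain (· ≤ ·) (Set.Iic t)) (hfin : ∀ t : S, (Set.Iic t).Finite)
    (g : StrongDual 𝕜 ℓ^∞(S, 𝕜)) {δ : ℝ} (hδ : 0 < δ) :
    {s : S | δ < ‖g (summation 𝕜 S (lp.single 1 s (1 : 𝕜)))‖}.Finite := by
  by_contra hA
  obtain ⟨a, haA, ha⟩ := exists_antichain_seq hfin hA
  let φ : ℕ → 𝕜 := fun n => g (summation 𝕜 S (lp.single 1 (a n) (1 : 𝕜)))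
  have hφ : ∀ n, δ < ‖φ n‖ := haA
  have hφ0 : ∀ n, φ n ≠ 0 := fun n => norm_pos_iff.1 (hδ.trans (hφ n))
  -- unimodular weights aligning the values of `g` on functions with disjoint supports
  let c : ℕ → 𝕜 := fun n => (‖φ n‖ : 𝕜) / φ n
  have hcn : ∀ n, ‖c n‖ = 1 := fun n => by
    simp [c, hφ0 n]
  obtain ⟨N, hN⟩ := exists_nat_gt (‖g‖ / δ)
  let v : ℓ^∞(S, 𝕜) := ∑ n ∈ Finset.range N, c n • summation 𝕜 S (lp.single 1 (a n) (1 : 𝕜))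
  have hv : ‖v‖ ≤ 1 := by
    refine lp.norm_le_of_forall_le zero_le_one fun t => ?_
    have hvt : v t = ∑ n ∈ Finset.range N, if a n ≤ t then c n else 0 := by
      simp only [v, lp.coeFn_sum, Finset.sum_apply, lp.coeFn_smul, Pi.smul_apply,
        summation_single, smul_eq_mul, mul_ite, mul_one, mul_zero]
    rw [hvt]
    by_cases h : ∃ m ∈ Finset.range N, a m ≤ t
    · obtain ⟨m, hm, hmt⟩ := h
      rw [Finset.sum_eq_single_of_mem m hm, if_pos hmt, hcn]
      intro n _ hnm
      refine if_neg fun hnt => ?_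
      rcases (hc t).total hmt hnt with h1 | h1
      · exact ha m n hnm.symm h1
      · exact ha n m hnm h1
    · push Not at h
      rw [Finset.sum_eq_zero fun n hn => if_neg (h n hn), norm_zero]
      exact zero_le_one
  have hgv : g v = ((∑ n ∈ Finset.range N, ‖φ n‖ : ℝ) : 𝕜) := by
    simp only [v, map_sum, map_smul, smul_eq_mul]
    refine Finset.sum_congr rfl fun n _ => ?_
    exact div_mul_cancel₀ _ (hφ0 n)
  have h1 : ∑ n ∈ Finset.range N, ‖φ n‖ ≤ ‖g‖ := by
    have h2 := (g.le_opNorm v).trans (mul_le_of_le_one_right (norm_nonneg _) hv)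
    rw [hgv, RCLike.norm_ofReal] at h2
    exact (le_abs_self _).trans h2
  have h3 : N * δ ≤ ∑ n ∈ Finset.range N, ‖φ n‖ := by
    have := Finset.card_nsmul_le_sum (Finset.range N) (fun n => ‖φ n‖) δ fun n _ => (hφ n).le
    simpa using this
  rw [div_lt_iff₀ hδ] at hN
  linarith

open Classical in
/-- A weak*-compact set of functionals on `ℓ₁` lying in `c₀` has nonempty relatively weak*-open
subsets of small norm diameter: by the Baire category theorem, the number of large coordinates
attains a locally maximal value at some point, and near that point the other coordinates are
small. -/
theorem exists_isOpen_small_of_c0 {S : Type u} {E : Set (WeakDual 𝕜 ℓ^1(S, 𝕜))}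
    (hE : IsCompact E) (hne : E.Nonempty)
    (hc0 : ∀ f ∈ E, ∀ δ : ℝ, 0 < δ → {s | δ < ‖f (lp.single 1 s (1 : 𝕜))‖}.Finite) {η : ℝ}
    (hη : 0 < η) :
    ∃ O : Set (WeakDual 𝕜 ℓ^1(S, 𝕜)), IsOpen O ∧ (E ∩ O).Nonempty ∧
      ∀ f ∈ E ∩ O, ∀ g ∈ E ∩ O, ‖WeakDual.toStrongDual f - WeakDual.toStrongDual g‖ ≤ η := by
  have : CompactSpace E := isCompact_iff_compactSpace.1 hE
  have : Nonempty E := hne.to_subtype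
  let δ : ℝ := η / 2
  have hδ : 0 < δ := half_pos hη
  let x : E → S → 𝕜 := fun f s => (f : WeakDual 𝕜 ℓ^1(S, 𝕜)) (lp.single 1 s (1 : 𝕜))
  have hx : ∀ s, Continuous fun f : E => x f s := fun s =>
    (WeakDual.eval_continuous _).comp continuous_subtype_val
  -- the points of `P n` have at most `n` coordinates of modulus greater than `δ`
  let P : ℕ → Set E := fun n => {f | ∀ A : Finset S, (∀ s ∈ A, δ < ‖x f s‖) → A.card ≤ n}
  have hPclosed : ∀ n, IsClosed (P n) := by
    intro n
    have h1 : P n = ⋂ (A : Finset S) (_ : n < A.card), {f | ∀ s ∈ A, δ < ‖x f s‖}ᶜ := by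
      ext f
      simp only [P, Set.mem_ofPred_eq, Set.mem_iInter, Set.mem_compl_iff]
      exact forall_congr' fun A => ⟨fun h hn hA => (h hA).not_gt hn,
        fun h hA => not_lt.1 fun hn => h hn hA⟩
    rw [h1]
    refine isClosed_iInter fun A => isClosed_iInter fun _ => IsOpen.isClosed_compl ?_
    simp only [Set.ofPred_forall]
    exact isOpen_biInter_finset fun s _ => isOpen_lt continuous_const (hx s).norm
  have hPU : ⋃ n, P n = Set.univ := by
    refine Set.eq_univ_of_forall fun f => Set.mem_iUnion.2 ⟨(hc0 f f.2 δ hδ).toFinset.card, ?_⟩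
    exact fun A hA => Finset.card_le_card fun s hs => (Set.Finite.mem_toFinset _).2 (hA s hs)
  have hex := nonempty_interior_of_iUnion_of_closed hPclosed hPU
  let n := Nat.find hex
  have hn : (interior (P n)).Nonempty := Nat.find_spec hex
  obtain ⟨f, hf, A, hA, hcard⟩ : ∃ f ∈ interior (P n), ∃ A : Finset S,
      (∀ s ∈ A, δ < ‖x f s‖) ∧ A.card = n := by
    by_contra! h
    rcases Nat.eq_zero_or_pos n with h0 | hpos
    · obtain ⟨f, hf⟩ := hn
      exact h f hf ∅ (by simp) (by simp [h0])
    · refine Nat.find_min hex (Nat.sub_lt hpos one_pos) (hn.mono ?_)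
      refine interior_maximal (fun f hf A hA => ?_) isOpen_interior
      have h1 := interior_subset hf A hA
      have h2 := h f hf A hA
      change A.card ≤ n - 1
      omega
  let O : Set E := interior (P n) ∩ ⋂ s ∈ A, {g | δ < ‖x g s‖ ∧ ‖x g s - x f s‖ < δ}
  have hO : IsOpen O := isOpen_interior.inter (isOpen_biInter_finset fun s _ =>
    (isOpen_lt continuous_const (hx s).norm).inter
      (isOpen_lt ((hx s).sub continuous_const).norm continuous_const))
  have hfO : f ∈ O := ⟨hf, Set.mem_iInter₂.2 fun s hs => ⟨hA s hs, by simpa using hδ⟩⟩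
  have hsmall : ∀ g ∈ O, ∀ s ∉ A, ‖x g s‖ ≤ δ := by
    intro g hg s hs
    by_contra! hlt
    have h1 := interior_subset hg.1 (insert s A) fun r hr => by
      rcases Finset.mem_insert.1 hr with rfl | hr
      · exact hlt
      · exact (Set.mem_iInter₂.1 hg.2 r hr).1
    rw [Finset.card_insert_of_notMem hs] at h1
    omega
  obtain ⟨O', hO', hO'O⟩ := isOpen_induced_iff.1 hO
  have hmem : ∀ g (hg : g ∈ E ∩ O'), (⟨g, hg.1⟩ : E) ∈ O := fun g hg => by
    rw [← hO'O]
    exact hg.2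
  refine ⟨O', hO', ⟨f, f.2, ?_⟩, fun g hg g' hg' => ?_⟩
  · rw [← hO'O] at hfO
    exact hfO
  · refine norm_le_of_norm_single_le _ hη.le fun s => ?_
    change ‖x ⟨g, hg.1⟩ s - x ⟨g', hg'.1⟩ s‖ ≤ η
    have hgO := hmem g hg
    have hgO' := hmem g' hg'
    have hδη : δ + δ = η := add_halves η
    by_cases hs : s ∈ A
    · have h1 := (Set.mem_iInter₂.1 hgO.2 s hs).2
      have h2 := (Set.mem_iInter₂.1 hgO'.2 s hs).2
      calc ‖x ⟨g, hg.1⟩ s - x ⟨g', hg'.1⟩ s‖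
          = ‖(x ⟨g, hg.1⟩ s - x f s) - (x ⟨g', hg'.1⟩ s - x f s)‖ := by
            rw [sub_sub_sub_cancel_right]
        _ ≤ ‖x ⟨g, hg.1⟩ s - x f s‖ + ‖x ⟨g', hg'.1⟩ s - x f s‖ := norm_sub_le _ _
        _ ≤ η := by linarith
    · have h1 := hsmall _ hgO s hs
      have h2 := hsmall _ hgO' s hs
      exact (norm_sub_le _ _).trans (by linarith)

/-- Let `F` be the image under an adjoint of a weak*-compact set `D`, all of whose nonempty compact
subsets have relatively open pieces of small diameter. Then `s_ε` removes a point of `F`: on a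
minimal compact subset of `D` with image `F`, a small piece is not dispensable, so its image has
nonempty relative interior in `F`. -/
theorem not_subset_szlenkDeriv_of_fragmented {X W : Type u} [NormedAddCommGroup X]
    [NormedSpace 𝕜 X] [NormedAddCommGroup W] [NormedSpace 𝕜 W] (U : W →L[𝕜] X)
    {D : Set (WeakDual 𝕜 X)} (hD : IsCompact D) (hDne : D.Nonempty)
    (hfrag : ∀ E ⊆ D, IsCompact E → E.Nonempty → ∀ η : ℝ, 0 < η →
      ∃ O : Set (WeakDual 𝕜 X), IsOpen O ∧ (E ∩ O).Nonempty ∧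
        ∀ f ∈ E ∩ O, ∀ g ∈ E ∩ O, ‖WeakDual.toStrongDual f - WeakDual.toStrongDual g‖ ≤ η)
    {ε : ℝ} (hε : 0 < ε) {F : Set (StrongDual 𝕜 W)}
    (hF : (StrongDual.toWeakDual '' F : Set (WeakDual 𝕜 W)) =
      (fun g : WeakDual 𝕜 X =>
        StrongDual.toWeakDual (WeakDual.toStrongDual g ∘L U : StrongDual 𝕜 W)) '' D) :
    ¬ F ⊆ szlenkDeriv ε F := by
  intro hperf
  let π : WeakDual 𝕜 X → WeakDual 𝕜 W := fun g =>
    StrongDual.toWeakDual (WeakDual.toStrongDual g ∘L U : StrongDual 𝕜 W)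
  have hπ : Continuous π := continuous_weakDual_comp U
  have : CompactSpace D := isCompact_iff_compactSpace.1 hD
  let p : D → π '' D := Set.imageFactorization π D
  have hp : Continuous p := (hπ.comp continuous_subtype_val).subtype_mk _
  obtain ⟨E, hE, hEimage, hEmin⟩ := exists_compact_surjective_zorn_subset hp
    Set.imageFactorization_surjective
  have hEne : E.Nonempty := by
    obtain ⟨d, hd⟩ := hDne
    obtain ⟨e, he, -⟩ : p ⟨d, hd⟩ ∈ p '' E := hEimage ▸ Set.mem_univ _
    exact ⟨e, he⟩
  have hEc : IsCompact (Subtype.val '' E) :=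
    (isCompact_iff_compactSpace.2 hE).image continuous_subtype_val
  obtain ⟨O, hO, ⟨_, ⟨e₀, he₀, rfl⟩, he₀O⟩, hsmall⟩ := hfrag _ (Subtype.coe_image_subset D E) hEc
    (hEne.image _) (ε / (‖U‖ + 1)) (by positivity)
  -- the image of the complement of `O` misses a point by minimality
  let E₀ : Set E := {e | ((e : D) : WeakDual 𝕜 X) ∉ O}
  have hE₀ : IsClosed E₀ := hO.isClosed_compl.preimage
    (continuous_subtype_val.comp continuous_subtype_val)
  have hE₀ne : E.domRestrict p '' E₀ ≠ Set.univ := hEmin E₀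
    (fun h => (h ▸ Set.mem_univ (⟨e₀, he₀⟩ : E) : (⟨e₀, he₀⟩ : E) ∈ E₀) he₀O) hE₀
  obtain ⟨⟨f, hfD⟩, hf⟩ := (Set.ne_univ_iff_exists_notMem _).1 hE₀ne
  have hcl : IsClosed (E.domRestrict p '' E₀) :=
    (hE₀.isCompact.image (hp.comp continuous_subtype_val)).isClosed
  obtain ⟨O', hO', hO'eq⟩ := isOpen_induced_iff.1 hcl.isOpen_compl
  have hlift : ∀ a ∈ F, StrongDual.toWeakDual a ∈ O' →
      ∃ e ∈ Subtype.val '' E ∩ O, π e = StrongDual.toWeakDual a := by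
    intro a ha haO'
    have haD : StrongDual.toWeakDual a ∈ π '' D := hF ▸ Set.mem_image_of_mem _ ha
    obtain ⟨e, he, hea⟩ : (⟨StrongDual.toWeakDual a, haD⟩ : π '' D) ∈ p '' E :=
      hEimage ▸ Set.mem_univ _
    refine ⟨e, ⟨⟨e, he, rfl⟩, ?_⟩, congrArg Subtype.val hea⟩
    by_contra heO
    have h1 : (⟨StrongDual.toWeakDual a, haD⟩ : π '' D) ∈ (E.domRestrict p '' E₀)ᶜ := by
      rw [← hO'eq]
      exact haO'
    exact h1 ⟨⟨e, he⟩, heO, hea⟩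
  obtain ⟨f', hf', rfl⟩ : f ∈ StrongDual.toWeakDual '' F := hF ▸ hfD
  have hfO' : StrongDual.toWeakDual f' ∈ O' := by
    have h1 : (⟨StrongDual.toWeakDual f', hfD⟩ : π '' D) ∈ Subtype.val ⁻¹' O' := by
      rw [hO'eq]
      exact hf
    exact h1
  refine ((hperf hf').2 O' hO' hfO').not_ge (Metric.ediam_le fun a ha b hb => ?_)
  obtain ⟨e, he, hea⟩ := hlift a ha.2 ha.1
  obtain ⟨e', he', heb⟩ := hlift b hb.2 hb.1
  rw [edist_dist, dist_eq_norm]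
  refine ENNReal.ofReal_le_ofReal ?_
  have hab : a - b = (WeakDual.toStrongDual e - WeakDual.toStrongDual e') ∘L U := by
    rw [← StrongDual.toWeakDual.injective hea, ← StrongDual.toWeakDual.injective heb]
    rfl
  calc ‖a - b‖ ≤ ‖WeakDual.toStrongDual e - WeakDual.toStrongDual e'‖ * ‖U‖ := by
        rw [hab]
        exact ContinuousLinearMap.opNorm_comp_le _ _
    _ ≤ ε / (‖U‖ + 1) * (‖U‖ + 1) := by
        gcongr
        · exact hsmall e he e' he'
        · linarith
    _ = ε := div_mul_cancel₀ _ (by positivity)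

end Fragmentability

/-! ### Nonexistence of universal operators beyond `ω₁` -/

section NonUniversal

variable {𝕜 : Type} [RCLike 𝕜]

/-- For an operator factoring through the summation operator of a well-founded tree, no nonempty
weak*-closed subset of the dual ball is contained in its Szlenk derivation. -/
theorem not_subset_szlenkDeriv_of_factorsThrough {T : BanachOperator.{u} 𝕜} {S : Type u}
    [PartialOrder S] [WellFoundedGT S] (hc : ∀ t : S, IsChain (· ≤ ·) (Set.Iic t))
    (hfin : ∀ t : S, (Set.Iic t).Finite) (hT : T.FactorsThrough (summationOperator 𝕜 S))
    {F : Set (StrongDual 𝕜 T.Dom)} (hFT : F ⊆ T.dualBall) (hFne : F.Nonempty)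
    (hF : IsClosed (StrongDual.toWeakDual '' F : Set (WeakDual 𝕜 T.Dom))) {ε : ℝ} (hε : 0 < ε) :
    ¬ F ⊆ szlenkDeriv ε F := by
  obtain ⟨U, V, hUV⟩ := hT
  let U' : T.Dom →L[𝕜] ℓ^1(S, 𝕜) := U
  let V' : ℓ^∞(S, 𝕜) →L[𝕜] T.Cod := V
  have hUV' : V' ∘L summation 𝕜 S ∘L U' = T.op := hUV
  let D : Set (WeakDual 𝕜 ℓ^1(S, 𝕜)) := (fun g : WeakDual 𝕜 T.Cod => StrongDual.toWeakDual
    (WeakDual.toStrongDual g ∘L (V' ∘L summation 𝕜 S) : StrongDual 𝕜 ℓ^1(S, 𝕜))) ''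
      T.adjointPreimage F
  have hD : IsCompact D :=
    (isCompact_adjointPreimage T hF).image (continuous_weakDual_comp (V' ∘L summation 𝕜 S))
  have hFD : (StrongDual.toWeakDual '' F : Set (WeakDual 𝕜 T.Dom)) =
      (fun g : WeakDual 𝕜 ℓ^1(S, 𝕜) => StrongDual.toWeakDual
        (WeakDual.toStrongDual g ∘L U' : StrongDual 𝕜 T.Dom)) '' D := by
    have hcomp : ∀ g : WeakDual 𝕜 T.Cod, (WeakDual.toStrongDual g ∘L (V' ∘L summation 𝕜 S)) ∘L U' =
        WeakDual.toStrongDual g ∘L T.op := fun g => by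
      rw [← hUV']
      rfl
    ext f
    constructor
    · rintro ⟨f, hf, rfl⟩
      obtain ⟨g, hg, rfl⟩ := hFT hf
      exact ⟨_, ⟨StrongDual.toWeakDual g, ⟨hg, hf⟩, rfl⟩,
        congrArg StrongDual.toWeakDual (hcomp (StrongDual.toWeakDual g))⟩
    · rintro ⟨_, ⟨g, hg, rfl⟩, rfl⟩
      exact ⟨_, hg.2, (congrArg StrongDual.toWeakDual (hcomp g)).symm⟩
  have hDne : D.Nonempty := by
    have h1 : (StrongDual.toWeakDual '' F : Set (WeakDual 𝕜 T.Dom)).Nonempty := hFne.image _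
    rw [hFD] at h1
    exact h1.of_image
  refine not_subset_szlenkDeriv_of_fragmented U' hD hDne (fun E hED hE hEne η hη => ?_) hε hFD
  refine exists_isOpen_small_of_c0 hE hEne (fun f hf δ hδ => ?_) hη
  obtain ⟨g, -, rfl⟩ := hED hf
  exact finite_setOf_lt_norm_summation hc hfin (WeakDual.toStrongDual g ∘L V') hδ

theorem not_exists_isUniversalFor {β : Ordinal.{u}} (hβ : ω_ 1 ≤ β) :
    ¬ ∃ Υ : BanachOperator.{u} 𝕜, IsUniversalFor Υ (SZ 𝕜 β)ᶜ := by
  rintro ⟨Υ, hΥ, huniv⟩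
  obtain ⟨ε, hε, hne⟩ := not_mem_SZ_iff.1 hΥ
  obtain ⟨𝒯, _, hcount, h𝒯⟩ := exists_countable_not_mem_SZ.{u} 𝕜
  obtain ⟨U, V, hUV⟩ := huniv _ (h𝒯 β)
  obtain ⟨ξ, hξ, hstable⟩ := exists_derived_stable (T := Υ) (S := Star 𝒯) U
    (V ∘L summation 𝕜 (Star 𝒯)) hUV ε
  obtain ⟨𝒮, _, hc, hfin, hwf, h𝒮⟩ := exists_wellFounded_not_mem_SZ.{u} 𝕜 β
  have hwf' : WellFoundedGT (Star 𝒮) := inferInstance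
  have hle : ξ ≤ ω ^ β := hξ.le.trans (hβ.trans (Ordinal.right_le_opow β Ordinal.one_lt_omega0))
  refine not_subset_szlenkDeriv_of_factorsThrough (S := Star 𝒮)
    (fun t r hr s hs hne => hc t hr hs fun h => hne (Subtype.ext h))
    (fun t => (hfin t).preimage Subtype.val_injective.injOn) (huniv _ h𝒮)
    (iterDeriv_subset (szlenkDeriv_subset ε) _ ξ)
    (hne.mono (iterDeriv_antitone (szlenkDeriv_subset ε) _ hle))
    (isClosed_iterDeriv_szlenkDeriv (isClosed_dualBall Υ) ξ) hε hstable

end NonUniversal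

end Szlenk

theorem mainTheorem2 (𝕜 : Type) [RCLike 𝕜] :
    (∀ α : Ordinal.{u}, α < ω_ 1 →
      ∀ (𝒯 : Type u) [PartialOrder 𝒯], Szlenk.IsTree 𝒯 → Countable 𝒯 → Infinite 𝒯 →
        Szlenk.IsRooted 𝒯 → Szlenk.IsWellFoundedTree 𝒯 → Szlenk.treeRank 𝒯 < ω ^ (α + 1) →
        (∀ T : Szlenk.BanachOperator.{u} 𝕜, T ∉ Szlenk.SZ 𝕜 α →
          (Szlenk.summationOperator 𝕜 (Szlenk.Star 𝒯)).FactorsThrough T) ∧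
        (Szlenk.IsBlossomed 𝒯 → ω ^ α ≤ Szlenk.treeRank 𝒯 →
          Szlenk.IsUniversalFor (Szlenk.summationOperator 𝕜 (Szlenk.Star 𝒯))
            (Szlenk.SZ 𝕜 α)ᶜ)) ∧
    (∀ β : Ordinal.{u},
      (∃ Υ : Szlenk.BanachOperator.{u} 𝕜, Szlenk.IsUniversalFor Υ (Szlenk.SZ 𝕜 β)ᶜ) ↔
        β < ω_ 1) := by
  have huniv : ∀ (α : Ordinal.{u}) (𝒯 : Type u) [PartialOrder 𝒯] [Infinite 𝒯],
      Szlenk.IsBlossomed 𝒯 → ω ^ α ≤ Szlenk.treeRank 𝒯 → Szlenk.treeRank 𝒯 < ω ^ (α + 1) →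
      Szlenk.IsUniversalFor (Szlenk.summationOperator 𝕜 (Szlenk.Star 𝒯)) (Szlenk.SZ 𝕜 α)ᶜ := by
    intro α 𝒯 _ _ hb hle hlt
    obtain ⟨htree, hcount, hroot, hwf, -⟩ := id hb
    have hfin : ∀ t : 𝒯, (Set.Iic t).Finite := fun t =>
      hwf.finite_of_isChain (htree.isChain_Iic t)
    exact ⟨Szlenk.summationOperator_not_mem_SZ htree.isChain_Iic hb.infinite_immSucc
        (Szlenk.derivedTree_opow_nonempty hfin hroot hle),
      fun T hT => Szlenk.summationOperator_factorsThrough_of_not_mem_SZ hT htree hroot hwf hlt⟩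
  refine ⟨fun α _ 𝒯 _ htree hcount hinf hroot hwf hlt =>
    ⟨fun T hT => Szlenk.summationOperator_factorsThrough_of_not_mem_SZ hT htree hroot hwf hlt,
      fun hb hle => huniv α 𝒯 hb hle hlt⟩, fun β => ⟨fun h => ?_, fun hβ => ?_⟩⟩
  · by_contra! hβ
    exact Szlenk.not_exists_isUniversalFor hβ h
  · have hω : (ω ^ β : Ordinal.{u}) < ω_ 1 :=
      Ordinal.isPrincipal_opow_omega 1 Ordinal.omega0_lt_omega_one hβ
    have hpos : (0 : Ordinal.{u}) < ω ^ β := Ordinal.opow_pos β Ordinal.omega0_pos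
    obtain ⟨𝒯, _, hb, hinf, hrank⟩ := Szlenk.exists_isBlossomed hω hpos
    refine ⟨_, huniv β 𝒯 hb (by rw [hrank]; exact le_self_add) ?_⟩
    have hlim : Order.IsSuccLimit (ω ^ (β + 1) : Ordinal.{u}) :=
      Ordinal.isSuccLimit_opow_left Ordinal.isSuccLimit_omega0 (by simp)
    rw [hrank]
    exact hlim.add_one_lt
      ((Ordinal.opow_lt_opow_iff_right Ordinal.one_lt_omega0).2 (Order.lt_add_one_iff.2 le_rfl))
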